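/- Let $q$ be a prime power and let $\mathbb K$ be an algebraic closure of $\mathbb F_{q^2}$. Let $\mathcal H_q$ be the Hermitian curve with homogeneous equation $X_2^qX_3+X_2X_3^q-X_1^{q+1}=0$ in the projective plane over $\mathbb K$, with function field $\mathbb K(x,y)$, $y^q+y=x^{q+1}$. Put $O=(0:0:1)$ and $Y_\infty=(0:1:0)$. Let $\mathrm{PGU}(3,q)$ be the group of those elements of $\mathrm{PGL}(3,q^2)$ that leave the set of $\mathbb F_{q^2}$-rational points of $\mathcal H_q$ invariant, and let $\Gamma$ be the stabilizer of both $O$ and $Y_\infty$ in $\mathrm{PGU}(3,q)$. Let $P_2,\dots,P_q$ be the points of $\mathcal H_q$ on the line $X_1=0$ other than $O$ and $Y_\infty$, i.e. the points $(0:b:1)$ with $b^q+b=0$, $b\neq0$. Fix an integer $m$ with $2\le m\le q-1$ and let $\mathtt G=m(P_2+\dots+P_q)$. Fix $u,v\in\mathbb F_{q^2}$ with $v^q+v=u^{q+1}$ and $u\ne0$, and a generator $\omega$ of $\mathbb F_{q^2}^*$; for $i=1,\dots,q^2-1$ let $Q_i=(\omega^iu:\omega^{(q+1)i}v:1)$,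 and let $\mathtt D=Q_1+\dots+Q_{q^2-1}$. Let $\mathcal L(\mathtt G)$ be the $\mathbb F_{q^2}$-vector space of all functions $f=g(x,y)/h(x,y)$ with $g,h\in\mathbb F_{q^2}[X,Y]$ such that $f=0$ or $\operatorname{div}(f)+\mathtt G\succcurlyeq0$ on $\mathcal H_q$, and let $ev_{\mathtt D}(f)=(f(Q_1),\dots,f(Q_{q^2-1}))$. Then $\Gamma$ is cyclic of order $q^2-1$, it leaves $\{P_2,\dots,P_q\}$ invariant, and the points $Q_1,\dots,Q_{q^2-1}$ are pairwise distinct and form the $\Gamma$-orbit of $(u:v:1)$. The map $ev_{\mathtt D}:\mathcal L(\mathtt G)\to\mathbb F_{q^2}^{\,q^2-1}$ is well defined and injective, and its image, the functional code $C_{\mathcal L}(\mathtt D,\mathtt G)$, is cyclic (invariant under the shift $(c_1,\dots,c_n)\mapsto(c_2,\dots,c_n,c_1)$, $n=q^2-1$) and is a $$\left[q^2-1,\ \tfrac12m(m-1)+1,\ d\right]_{q^2}$$ linear code whose minimum distance $d$ satisfies $$q^2-1-(q(m-1)-1)\ \le\ d\ \le\ q^2-1-(m-2)(q+1).$$ In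 particular $d$ exceeds the designed minimum distance $q^2-1-\deg\mathtt G$ by at least $q+1-m$. -/

import Mathlib

open scoped LinearAlgebra.Projectivization MatrixGroups Pointwise

noncomputable section

namespace HermitianCode

/-! ## The Hermitian curve in the projective plane

The coordinates `(X₁ : X₂ : X₃)` are indexed by `0, 1, 2 : Fin 3`. -/

section Curve

variable (q : ℕ) (k : Type*) [Field k]

/-- The form `X₂^q X₃ + X₂ X₃^q - X₁^(q+1)`. -/
def form : MvPolynomial (Fin 3) k :=
  MvPolynomial.X 1 ^ q * MvPolynomial.X 2 + MvPolynomial.X 1 * MvPolynomial.X 2 ^ q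
    - MvPolynomial.X 0 ^ (q + 1)

/-- The `k`-rational points of the Hermitian curve, as a set of points of the plane over `k`. -/
def curve : Set (ℙ k (Fin 3 → k)) :=
  {P | MvPolynomial.eval P.rep (form q k) = 0}

variable {q k}

theorem eval_form_rep {w : Fin 3 → k} (hw : w ≠ 0)
    (h : MvPolynomial.eval w (form q k) = 0) :
    MvPolynomial.eval (Projectivization.mk k w hw).rep (form q k) = 0 := by
  obtain ⟨a, ha⟩ := Projectivization.exists_smul_eq_mk_rep k w hw
  have hs : MvPolynomial.eval (a • w) (form q k) =
      (a : k) ^ (q + 1) * MvPolynomial.eval w (form q k) := by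
    simp only [form, map_sub, map_add, map_mul, map_pow, MvPolynomial.eval_X, Pi.smul_apply,
      Units.smul_def, smul_eq_mul]
    ring
  rw [← ha, hs, h, mul_zero]

theorem affine_ne_zero (a b : k) : (![a, b, 1] : Fin 3 → k) ≠ 0 := fun h => by
  simpa using congrFun h 2

/-- The affine point `(a : b : 1)`. -/
def affinePoint (a b : k) (h : b ^ q + b = a ^ (q + 1)) : curve q k :=
  ⟨Projectivization.mk k ![a, b, 1] (affine_ne_zero a b),
    eval_form_rep _ (by simp [form, h])⟩

variable (k) in
/-- The origin `O = (0 : 0 : 1)`. -/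
def originPt : ℙ k (Fin 3 → k) := Projectivization.mk k ![0, 0, 1] (affine_ne_zero 0 0)

variable (k) in
/-- The point at infinity `Y_∞ = (0 : 1 : 0)`. -/
def infinityPt : ℙ k (Fin 3 → k) :=
  Projectivization.mk k ![0, 1, 0] fun h => by simpa using congrFun h 1

/-- A rational point, seen as a point over an extension field. -/
def baseChange {k : Type*} [Field k] (K : Type*) [Field K] [Algebra k K] (P : curve q k) :
    curve q K :=
  ⟨Projectivization.mk K (fun i => algebraMap k K (P.1.rep i)) fun h =>
      P.1.rep_nonzero (funext fun i => (algebraMap k K).injective (by simpa using congrFun h i)),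
    eval_form_rep _ (by
      have h : MvPolynomial.eval P.1.rep (form q k) = 0 := P.2
      have h' := congrArg (algebraMap k K) h
      simpa [form] using h')⟩

end Curve

/-! ## The function field -/

section FunctionField

variable (q : ℕ) (k : Type*) [Field k]

open Polynomial in
/-- The affine equation `x^(q+1) - (y^q + y)`: the inner variable is `y`, the outer one `x`. -/
def affinePoly : k[X][X] := X ^ (q + 1) - C (X ^ q + X)

/-- The affine coordinate ring `k[x, y]` with `y^q + y = x^(q+1)`. -/
abbrev CoordRing := AdjoinRoot (affinePoly q k)

/-- The function field `k(x, y)` of the Hermitian curve. -/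
abbrev FunctionField := FractionRing (CoordRing q k)

open Polynomial in
theorem affinePoly_irreducible (hq : 1 < q) : Irreducible (affinePoly q k) := by
  have hm : (affinePoly q k).Monic := monic_X_pow_sub_C _ (Nat.succ_ne_zero q)
  have hd : (affinePoly q k).degree = ((q + 1 : ℕ) : WithBot ℕ) :=
    degree_X_pow_sub_C (Nat.succ_pos q) _
  have hp : (Ideal.span {(X : k[X])}).IsPrime :=
    (Ideal.span_singleton_prime X_ne_zero).2 prime_X
  refine irreducible_of_eisenstein_criterion hp ?_ ?_ ?_ ?_ hm.isPrimitive
  · rw [hm.leadingCoeff]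
    exact fun h => hp.ne_top ((Ideal.eq_top_iff_one _).2 h)
  · intro n hn
    rw [hd, Nat.cast_lt] at hn
    rw [affinePoly, coeff_sub, coeff_X_pow, if_neg hn.ne, zero_sub, coeff_C]
    split_ifs
    · refine Ideal.neg_mem_iff _ |>.2 (Ideal.mem_span_singleton.2 ?_)
      exact dvd_add (dvd_pow_self _ (by omega)) dvd_rfl
    · simp
  · rw [hd]; exact_mod_cast Nat.succ_pos q
  · rw [affinePoly, coeff_sub, coeff_X_pow, if_neg (by omega), zero_sub, coeff_C_zero,
      Ideal.span_singleton_pow, Ideal.mem_span_singleton, dvd_neg, X_pow_dvd_iff]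
    intro h
    have := h 1 (by norm_num)
    rw [coeff_add, coeff_X_pow, if_neg (by omega), coeff_X_one] at this
    simp at this

instance [hq : Fact (1 < q)] : IsDomain (CoordRing q k) :=
  AdjoinRoot.isDomain_of_prime (affinePoly_irreducible q k hq.out).prime

variable {q k}

/-- The coordinate function `x`. -/
def xFun : FunctionField q k := algebraMap (CoordRing q k) _ (AdjoinRoot.root _)

/-- The coordinate function `y`. -/
def yFun : FunctionField q k :=
  algebraMap (CoordRing q k) _ (AdjoinRoot.of _ Polynomial.X)

/-- The value `A(x, y, 1)` of a polynomial `A(X₁, X₂, X₃)` in the function field. -/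
def dehom : MvPolynomial (Fin 3) k →ₐ[k] FunctionField q k :=
  MvPolynomial.aeval ![xFun, yFun, 1]

variable [Fact (1 < q)]

/-- `f` is regular at `P` and `f(P) = c`: it is a quotient `A/B` of forms of the same degree with
`B(P) ≠ 0` and `A(P)/B(P) = c`. -/
def HasValueAt (f : FunctionField q k) (P : curve q k) (c : k) : Prop :=
  ∃ (n : ℕ) (A B : MvPolynomial (Fin 3) k), A.IsHomogeneous n ∧ B.IsHomogeneous n ∧
    dehom (q := q) B ≠ 0 ∧ MvPolynomial.eval P.1.rep B ≠ 0 ∧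
    f = dehom A / dehom B ∧
    MvPolynomial.eval P.1.rep A / MvPolynomial.eval P.1.rep B = c

/-- `f` lies in the local ring of the curve at `P`. -/
def IsRegularAt (f : FunctionField q k) (P : curve q k) : Prop := ∃ c, HasValueAt f P c

/-- `t` generates the maximal ideal of the local ring at `P`. -/
def IsUniformizerAt (t : FunctionField q k) (P : curve q k) : Prop :=
  HasValueAt t P 0 ∧
    ∀ s, HasValueAt s P 0 → ∃ r, IsRegularAt r P ∧ s = r * t

/-- `ord_P(f) ≥ n`. -/
def OrdGE (P : curve q k) (n : ℤ) (f : FunctionField q k) : Prop :=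
  ∃ t, IsUniformizerAt t P ∧ ∃ r, IsRegularAt r P ∧ f = r * t ^ n

/-- `f = g(x, y) / h(x, y)` with `g`, `h` polynomials over the subfield `L`. -/
def IsDefinedOver (L : Type*) [Field L] [Algebra L k] (f : FunctionField q k) : Prop :=
  ∃ g h : MvPolynomial (Fin 2) L,
    MvPolynomial.aeval ![(xFun : FunctionField q k), yFun] h ≠ 0 ∧
    f = MvPolynomial.aeval ![(xFun : FunctionField q k), yFun] g /
      MvPolynomial.aeval ![(xFun : FunctionField q k), yFun] h

theorem HasValueAt.add {f g : FunctionField q k} {P : curve q k} {c d : k}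
    (hf : HasValueAt f P c) (hg : HasValueAt g P d) : HasValueAt (f + g) P (c + d) := by
  obtain ⟨n, A, B, hA, hB, hB0, hBP, rfl, rfl⟩ := hf
  obtain ⟨n', A', B', hA', hB', hB0', hBP', rfl, rfl⟩ := hg
  refine ⟨n + n', A * B' + B * A', B * B', (hA.mul hB').add (hB.mul hA'), hB.mul hB', ?_, ?_, ?_,
    ?_⟩
  · rw [map_mul]; exact mul_ne_zero hB0 hB0'
  · rw [map_mul]; exact mul_ne_zero hBP hBP'
  · rw [map_add, map_mul, map_mul, map_mul, div_add_div _ _ hB0 hB0']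
  · rw [map_add, map_mul, map_mul, map_mul, div_add_div _ _ hBP hBP']

theorem HasValueAt.mul {f g : FunctionField q k} {P : curve q k} {c d : k}
    (hf : HasValueAt f P c) (hg : HasValueAt g P d) : HasValueAt (f * g) P (c * d) := by
  obtain ⟨n, A, B, hA, hB, hB0, hBP, rfl, rfl⟩ := hf
  obtain ⟨n', A', B', hA', hB', hB0', hBP', rfl, rfl⟩ := hg
  refine ⟨n + n', A * A', B * B', hA.mul hA', hB.mul hB', ?_, ?_, ?_, ?_⟩
  · rw [map_mul]; exact mul_ne_zero hB0 hB0'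
  · rw [map_mul]; exact mul_ne_zero hBP hBP'
  · rw [map_mul, map_mul, div_mul_div_comm]
  · rw [map_mul, map_mul, div_mul_div_comm]

theorem HasValueAt.const (P : curve q k) (c : k) :
    HasValueAt (algebraMap k (FunctionField q k) c) P c := by
  refine ⟨0, MvPolynomial.C c, 1, MvPolynomial.isHomogeneous_C _ _,
    MvPolynomial.isHomogeneous_one _ _, ?_, ?_, ?_, ?_⟩ <;> simp [dehom]

theorem IsRegularAt.add {f g : FunctionField q k} {P : curve q k}
    (hf : IsRegularAt f P) (hg : IsRegularAt g P) : IsRegularAt (f + g) P :=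
  ⟨_, hf.choose_spec.add hg.choose_spec⟩

theorem IsRegularAt.mul {f g : FunctionField q k} {P : curve q k}
    (hf : IsRegularAt f P) (hg : IsRegularAt g P) : IsRegularAt (f * g) P :=
  ⟨_, hf.choose_spec.mul hg.choose_spec⟩

theorem IsRegularAt.const (P : curve q k) (c : k) :
    IsRegularAt (algebraMap k (FunctionField q k) c) P := ⟨c, .const P c⟩

theorem IsRegularAt.pow {f : FunctionField q k} {P : curve q k}
    (hf : IsRegularAt f P) (n : ℕ) : IsRegularAt (f ^ n) P := by
  induction n with
  | zero => simpa using IsRegularAt.const P 1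
  | succ n ih => rw [pow_succ]; exact ih.mul hf

/-- Two uniformizers differ by a unit of the local ring. -/
theorem IsUniformizerAt.zpow_eq {t t' : FunctionField q k} {P : curve q k}
    (ht : IsUniformizerAt t P) (ht' : IsUniformizerAt t' P) (n : ℤ) :
    ∃ r, IsRegularAt r P ∧ t' ^ n = r * t ^ n := by
  obtain ⟨a, ha, hat⟩ := ht.2 t' ht'.1
  obtain ⟨b, hb, hbt⟩ := ht'.2 t ht.1
  by_cases h0 : t = 0
  · have : t' = 0 := by rw [hat, h0, mul_zero]
    exact ⟨1, by simpa using IsRegularAt.const P 1, by rw [this, h0, one_mul]⟩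
  · have hba : b * a = 1 := by
      apply mul_right_cancel₀ h0
      rw [one_mul, mul_assoc, ← hat, ← hbt]
    refine ⟨a ^ n, ?_, by rw [hat, mul_zpow]⟩
    obtain ⟨j, rfl | rfl⟩ := n.eq_nat_or_neg
    · rw [zpow_natCast]; exact ha.pow j
    · rw [zpow_neg, zpow_natCast, ← inv_pow, ← eq_inv_of_mul_eq_one_left hba]
      exact hb.pow j

theorem OrdGE.add {P : curve q k} {n : ℤ} {f g : FunctionField q k}
    (hf : OrdGE P n f) (hg : OrdGE P n g) : OrdGE P n (f + g) := by
  obtain ⟨t, ht, r, hr, rfl⟩ := hf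
  obtain ⟨t', ht', r', hr', rfl⟩ := hg
  obtain ⟨a, ha, hat⟩ := ht.zpow_eq ht' n
  exact ⟨t, ht, r + r' * a, hr.add (hr'.mul ha), by rw [hat]; ring⟩

theorem IsDefinedOver.add {L : Type*} [Field L] [Algebra L k] {f g : FunctionField q k}
    (hf : IsDefinedOver L f) (hg : IsDefinedOver L g) : IsDefinedOver L (f + g) := by
  obtain ⟨a, b, hb, rfl⟩ := hf
  obtain ⟨a', b', hb', rfl⟩ := hg
  refine ⟨a * b' + b * a', b * b', ?_, ?_⟩
  · rw [map_mul]; exact mul_ne_zero hb hb'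
  · rw [map_add, map_mul, map_mul, map_mul, div_add_div _ _ hb hb']

/-! ## Divisors, Riemann-Roch spaces and functional codes

In this part `k` is meant to be algebraically closed, and `L` is a subfield of it. -/

variable (q k) in
/-- Divisors: formal sums of points of the curve. -/
abbrev Divisor := curve q k →₀ ℤ

/-- The degree of a divisor. -/
def Divisor.deg (G : Divisor q k) : ℤ := G.sum fun _ n => n

/-- The Riemann-Roch space of `G` over `L`: the functions defined over `L` that are zero or have
`ord_P(f) + G(P) ≥ 0` at all points `P`. -/
def riemannRoch (L : Type*) [Field L] [Algebra L k] (G : Divisor q k) :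
    Submodule L (FunctionField q k) where
  carrier := {f | IsDefinedOver L f ∧ (f = 0 ∨ ∀ P, OrdGE P (-G P) f)}
  zero_mem' := ⟨⟨0, 1, by simp, by simp⟩, Or.inl rfl⟩
  add_mem' := by
    rintro f g ⟨hf, hf'⟩ ⟨hg, hg'⟩
    refine ⟨hf.add hg, ?_⟩
    rcases hf' with rfl | hf'
    · rwa [zero_add]
    rcases hg' with rfl | hg'
    · rw [add_zero]; exact Or.inr hf'
    exact Or.inr fun P => (hf' P).add (hg' P)
  smul_mem' := by
    rintro c f ⟨⟨g, h, hh, hfg⟩, hf'⟩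
    refine ⟨⟨c • g, h, hh, by rw [hfg, map_smul, smul_div_assoc]⟩, ?_⟩
    rcases hf' with rfl | hf'
    · left; rw [smul_zero]
    right
    intro P
    obtain ⟨t, ht, r, hr, hfr⟩ := hf' P
    refine ⟨t, ht, c • r, ?_, by rw [hfr, smul_mul_assoc]⟩
    rw [← IsScalarTower.algebraMap_smul k c r, Algebra.smul_def]
    exact (IsRegularAt.const P _).mul hr

/-- The values of `f` at the rational points `Q i` are the `c i`, i.e. `ev_D(f) = c`. -/
def HasEvaluation {L : Type*} [Field L] [Algebra L k] {n : ℕ} (Q : Fin n → curve q L)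
    (f : FunctionField q k) (c : Fin n → L) : Prop :=
  ∀ i, HasValueAt f (baseChange k (Q i)) (algebraMap L k (c i))

/-- The functional code `C_L(D, G)`, the image of `ev_D` on the Riemann-Roch space of `G`
over `L`, where `D = Q_1 + ⋯ + Q_n`. -/
def functionalCode {L : Type*} [Field L] [Algebra L k] {n : ℕ} (Q : Fin n → curve q L)
    (G : Divisor q k) : Submodule L (Fin n → L) where
  carrier := {c | ∃ f ∈ riemannRoch L G, HasEvaluation Q f c}
  zero_mem' := ⟨0, zero_mem _, fun i => by simpa using HasValueAt.const (baseChange k (Q i)) 0⟩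
  add_mem' := by
    rintro c d ⟨f, hf, hfc⟩ ⟨g, hg, hgd⟩
    exact ⟨f + g, add_mem hf hg, fun i => by simpa using (hfc i).add (hgd i)⟩
  smul_mem' := by
    rintro a c ⟨f, hf, hfc⟩
    refine ⟨a • f, Submodule.smul_mem _ a hf, fun i => ?_⟩
    rw [← IsScalarTower.algebraMap_smul k a f, Algebra.smul_def]
    simpa using (HasValueAt.const _ _).mul (hfc i)

/-- The designed minimum distance `n - deg G`. -/
def designedDistance (n : ℕ) (G : Divisor q k) : ℤ := n - G.deg

end FunctionField

/-! ## Linear codes -/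

/-- Invariance under the cyclic shift `(c_1, …, c_n) ↦ (c_2, …, c_n, c_1)`. -/
def IsCyclicCode {L : Type*} [Field L] {n : ℕ} (C : Submodule L (Fin n → L)) : Prop :=
  ∀ c ∈ C, (fun i => c (finRotate n i)) ∈ C

open Classical in
/-- `d` is the minimum Hamming distance between distinct codewords of `C`. -/
def IsMinDistance {L : Type*} [Field L] {n : ℕ} (C : Submodule L (Fin n → L)) (d : ℕ) : Prop :=
  IsLeast {w | ∃ c ∈ C, ∃ c' ∈ C, c ≠ c' ∧ hammingDist c c' = w} d

/-! ## The two-point stabilizer, its orbits and the divisor on the chord -/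

section Chord

variable (q : ℕ) (L : Type*) [Field L]

/-- For `L` of order `q^2`, this is `PGU(3, q)`: the elements of `PGL(3, L)` that leave the set of
`L`-rational points of the Hermitian curve invariant. -/
def PGU : Subgroup PGL(3, L) := MulAction.stabilizer PGL(3, L) (curve q L)

/-- The stabilizer in `PGU(3, q)` of the two points `O` and `Y_∞`. -/
def twoPointStabilizer : Subgroup PGL(3, L) :=
  PGU q L ⊓ MulAction.stabilizer PGL(3, L) (originPt L) ⊓
    MulAction.stabilizer PGL(3, L) (infinityPt L)

variable {q L}

/-- The points `(0 : b : 1)` of the curve other than `O`, with `b^q + b = 0` and `b ≠ 0`: the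
rational points of the curve on the chord `O Y_∞`, without `O` and `Y_∞`. -/
def chordPoint (b : {b : L // b ≠ 0 ∧ b ^ q + b = 0}) : curve q L :=
  affinePoint 0 b.1 (by rw [b.2.2, zero_pow (Nat.succ_ne_zero q)])

open Classical in
variable (q L) in
/-- The divisor `m (P_2 + ⋯ + P_q)`, where `P_2, …, P_q` are the points of the curve on the chord
`O Y_∞` other than `O` and `Y_∞`. -/
def chordDivisor [Fintype L] (k : Type*) [Field k] [Algebra L k] (m : ℕ) : Divisor q k :=
  m • ∑ b : {b : L // b ≠ 0 ∧ b ^ q + b = 0}, Finsupp.single (baseChange k (chordPoint b)) 1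

theorem orbit_eq [Fintype L] (hL : Fintype.card L = q ^ 2) (w u v : L)
    (huv : v ^ q + v = u ^ (q + 1)) :
    (w ^ (q + 1) * v) ^ q + w ^ (q + 1) * v = (w * u) ^ (q + 1) := by
  have hw : w ^ (q ^ 2) = w := hL ▸ FiniteField.pow_card w
  have h2 : (w ^ (q + 1)) ^ q = w ^ (q + 1) := by
    rw [← pow_mul, show (q + 1) * q = q ^ 2 + q by ring, pow_add, hw, pow_succ']
  rw [mul_pow, h2, mul_pow, ← huv]
  ring

/-- The points `Q_j = (ω^j u : ω^((q+1) j) v : 1)` for `j = 1, …, q^2 - 1`, with `j = i + 1`. -/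
def orbitPoint [Fintype L] (hL : Fintype.card L = q ^ 2) (ω : Lˣ) (u v : L)
    (huv : v ^ q + v = u ^ (q + 1)) (i : Fin (q ^ 2 - 1)) : curve q L :=
  affinePoint ((ω : L) ^ (i.1 + 1) * u) (((ω : L) ^ (i.1 + 1)) ^ (q + 1) * v)
    (orbit_eq hL _ u v huv)

end Chord

end HermitianCode

end

/-!
A function `f` of the Riemann-Roch space of the chord divisor becomes regular on the affine curve
after multiplication by `x ^ m`, hence a combination of the monomials `x ^ i * y ^ j` with `i ≤ q`.
These have pairwise distinct orders at `O`, and pairwise distinct orders at `Y_∞`, so the orders of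
`f` at the two points bound the orders of its terms separately. What remains are the exponents
`(m, 0)` and those with `1 ≤ j` and `i + j < m`. The restriction of such a function
`x ^ i * y ^ j / x ^ m` to the orbit `T ↦ (T u : T ^ (q + 1) v : 1)` is a monomial in `T`; the
exponents of `T` are distinct and at most `q (m - 1) - 1`, which gives the dimension and the lower
bound on the minimum distance. The upper bound comes from functions `y h(y) / x ^ m`, where `h` is
a product of `m - 2` factors `y - ξ ^ l v`, each vanishing at `q + 1` points of the orbit, with `ξ`
a generator of the group of `(q + 1)`-th powers. The stabilizer of `O` and `Y_∞` consists of the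
diagonal elements `diag(a, a ^ (q + 1), 1)`, which act on the orbit by scaling `T`.
-/

noncomputable section

namespace HermitianCode

/-! ## The coordinate ring -/

section Homogeneous

variable {R S σ : Type*} [CommSemiring R] [CommSemiring S] [Algebra R S]

theorem aeval_smul_of_isHomogeneous {n : ℕ} {A : MvPolynomial σ R} (hA : A.IsHomogeneous n)
    (l : S) (w : σ → S) :
    MvPolynomial.aeval (l • w) A = l ^ n * MvPolynomial.aeval w A := by
  simp only [MvPolynomial.aeval_eq_eval₂Hom, MvPolynomial.coe_eval₂Hom, MvPolynomial.eval₂_eq,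
    Finset.mul_sum]
  refine Finset.sum_congr rfl fun d hd => ?_
  have hdeg : ∑ i ∈ d.support, d i = n := by
    rw [← Finsupp.degree_apply, Finsupp.degree_eq_weight_one]
    exact hA (MvPolynomial.mem_support_iff.1 hd)
  simp only [Pi.smul_apply, smul_eq_mul, mul_pow, Finset.prod_mul_distrib,
    Finset.prod_pow_eq_pow_sum, hdeg]
  exact mul_left_comm _ _ _

theorem eval_smul_of_isHomogeneous {n : ℕ} {A : MvPolynomial σ R} (hA : A.IsHomogeneous n)
    (l : R) (w : σ → R) :
    MvPolynomial.eval (l • w) A = l ^ n * MvPolynomial.eval w A := by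
  simpa only [MvPolynomial.aeval_eq_eval] using aeval_smul_of_isHomogeneous hA l w

end Homogeneous

section CoordinateRing

variable {q : ℕ} {k : Type*} [Field k]

/-- The coordinate function `x`, as an element of the coordinate ring. -/
def coordX : CoordRing q k := AdjoinRoot.root _

/-- The coordinate function `y`, as an element of the coordinate ring. -/
def coordY : CoordRing q k := AdjoinRoot.of _ Polynomial.X

/-- The monomial `x ^ i * y ^ j` with `(i, j) = s`. Those with `i ≤ q` form a basis of the
coordinate ring. -/
def coordMonomial (s : ℕ × ℕ) : CoordRing q k := coordX ^ s.1 * coordY ^ s.2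

theorem monic_affinePoly : (affinePoly q k).Monic :=
  Polynomial.monic_X_pow_sub_C _ (Nat.succ_ne_zero q)

theorem natDegree_affinePoly : (affinePoly q k).natDegree = q + 1 :=
  Polynomial.natDegree_X_pow_sub_C

theorem coordY_pow_add_coordY : (coordY : CoordRing q k) ^ q + coordY = coordX ^ (q + 1) := by
  have h : AdjoinRoot.mk (affinePoly q k) (Polynomial.X ^ (q + 1) -
      Polynomial.C (Polynomial.X ^ q + Polynomial.X)) = 0 := AdjoinRoot.mk_self
  rw [map_sub, map_pow, AdjoinRoot.mk_X, AdjoinRoot.mk_C, map_add (AdjoinRoot.of _), map_pow,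
    sub_eq_zero] at h
  exact h.symm

theorem yFun_pow_add_yFun : (yFun : FunctionField q k) ^ q + yFun = xFun ^ (q + 1) := by
  have h := congrArg (algebraMap (CoordRing q k) (FunctionField q k)) coordY_pow_add_coordY
  rwa [map_add, map_pow, map_pow] at h

theorem algebraMap_coordMonomial (s : ℕ × ℕ) :
    algebraMap (CoordRing q k) (FunctionField q k) (coordMonomial s) =
      xFun ^ s.1 * yFun ^ s.2 := by
  rw [coordMonomial, map_mul, map_pow, map_pow]
  rfl

theorem mem_span_coordMonomial (g : CoordRing q k) :
    g ∈ Submodule.span k (coordMonomial '' {s : ℕ × ℕ | s.1 ≤ q}) := by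
  obtain ⟨p, rfl⟩ := AdjoinRoot.mk_surjective g
  have hdeg : (p %ₘ affinePoly q k).natDegree < q + 1 :=
    natDegree_affinePoly (q := q) (k := k) ▸ Polynomial.natDegree_modByMonic_lt _ monic_affinePoly
      fun h => by simpa [h] using natDegree_affinePoly (q := q) (k := k)
  rw [← AdjoinRoot.mk_leftInverse monic_affinePoly (AdjoinRoot.mk _ p),
    AdjoinRoot.modByMonicHom_mk, Polynomial.as_sum_range' _ _ hdeg, map_sum]
  refine Submodule.sum_mem _ fun i hi => ?_
  generalize (p %ₘ affinePoly q k).coeff i = a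
  rw [← Polynomial.C_mul_X_pow_eq_monomial, map_mul, map_pow, AdjoinRoot.mk_X, AdjoinRoot.mk_C,
    Polynomial.as_sum_range a, map_sum, Finset.sum_mul]
  refine Submodule.sum_mem _ fun j _ => ?_
  have hterm : AdjoinRoot.of (affinePoly q k) (Polynomial.monomial j (a.coeff j)) *
      AdjoinRoot.root (affinePoly q k) ^ i = a.coeff j • coordMonomial (i, j) := by
    rw [← Polynomial.C_mul_X_pow_eq_monomial, map_mul, map_pow, Algebra.smul_def, mul_assoc,
      mul_comm (_ ^ j)]
    rfl
  rw [hterm]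
  exact Submodule.smul_mem _ _
    (Submodule.subset_span ⟨(i, j), Nat.lt_succ_iff.1 (Finset.mem_range.1 hi), rfl⟩)

/-- The homomorphism from the coordinate ring given by a point of the affine curve. -/
def coordLift {S : Type*} [CommRing S] [Algebra k S] (a b : S) (h : b ^ q + b = a ^ (q + 1)) :
    CoordRing q k →ₐ[k] S :=
  AdjoinRoot.liftAlgHom (affinePoly q k) (Polynomial.aeval b) a (by
    simp [affinePoly, Polynomial.eval₂_sub, Polynomial.eval₂_pow, Polynomial.eval₂_X,
      Polynomial.eval₂_C, h])

section CoordLift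

variable {S : Type*} [CommRing S] [Algebra k S] (a b : S) (h : b ^ q + b = a ^ (q + 1))

@[simp]
theorem coordLift_coordX : coordLift (k := k) a b h coordX = a :=
  AdjoinRoot.liftAlgHom_root _ _ _ _

@[simp]
theorem coordLift_coordY : coordLift (k := k) a b h coordY = b := by
  simp [coordLift, coordY]

theorem coordLift_coordMonomial (s : ℕ × ℕ) :
    coordLift (k := k) a b h (coordMonomial s) = a ^ s.1 * b ^ s.2 := by
  simp [coordMonomial]

end CoordLift

variable [hq : Fact (1 < q)]

theorem xFun_ne_zero : (xFun : FunctionField q k) ≠ 0 := by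
  refine fun h => AdjoinRoot.mk_ne_zero_of_natDegree_lt monic_affinePoly Polynomial.X_ne_zero ?_
    (IsFractionRing.injective (CoordRing q k) (FunctionField q k) (h.trans (map_zero _).symm))
  rw [natDegree_affinePoly, Polynomial.natDegree_X]
  exact hq.out.trans q.lt_succ_self

theorem yFun_ne_zero : (yFun : FunctionField q k) ≠ 0 := fun h => by
  have hpow := yFun_pow_add_yFun (q := q) (k := k)
  rw [h, zero_pow (Nat.ne_zero_of_lt hq.out), add_zero] at hpow
  exact xFun_ne_zero (eq_zero_of_pow_eq_zero hpow.symm)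

end CoordinateRing

section Points

variable {q : ℕ} {k : Type*} [Field k]

theorem affinePoint_inj {a b a' b' : k} {h : b ^ q + b = a ^ (q + 1)}
    {h' : b' ^ q + b' = a' ^ (q + 1)} :
    affinePoint a b h = affinePoint a' b' h' ↔ a = a' ∧ b = b' := by
  refine ⟨fun he => ?_, by rintro ⟨rfl, rfl⟩; rfl⟩
  obtain ⟨c, hc⟩ := (Projectivization.mk_eq_mk_iff' _ _ _ _ _).1 (congrArg Subtype.val he)
  obtain rfl : c = 1 := by simpa using congrFun hc 2
  exact ⟨by simpa using (congrFun hc 0).symm, by simpa using (congrFun hc 1).symm⟩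

/-- The point `Y_∞`, as a point of the curve. -/
def infinityCurvePoint (hq : 1 < q) : curve q k :=
  ⟨infinityPt k, eval_form_rep _ (by simp [form, Nat.ne_zero_of_lt hq])⟩

theorem affinePoint_ne_infinityCurvePoint (hq : 1 < q) {a b : k} {h : b ^ q + b = a ^ (q + 1)} :
    affinePoint a b h ≠ infinityCurvePoint hq := fun he => by
  obtain ⟨c, hc⟩ := (Projectivization.mk_eq_mk_iff' _ _ _ _ _).1 (congrArg Subtype.val he)
  simpa using congrFun hc 2

theorem eq_infinityCurvePoint_or_eq_affinePoint (hq : 1 < q) (P : curve q k) :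
    P = infinityCurvePoint hq ∨ ∃ a b h, P = affinePoint a b h := by
  obtain ⟨w, hw0, hmk, hw⟩ : ∃ (w : Fin 3 → k) (hw0 : w ≠ 0),
      Projectivization.mk k w hw0 = P.1 ∧ MvPolynomial.eval w (form q k) = 0 :=
    ⟨_, P.1.rep_nonzero, P.1.mk_rep, P.2⟩
  simp only [form, map_sub, map_add, map_mul, map_pow, MvPolynomial.eval_X] at hw
  by_cases h2 : w 2 = 0
  · left
    have h0 : w 0 = 0 := by simpa [h2, Nat.ne_zero_of_lt hq] using hw
    refine Subtype.ext (hmk.symm.trans ((Projectivization.mk_eq_mk_iff' _ _ _ _ _).2 ⟨w 1, ?_⟩))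
    ext i
    fin_cases i <;> simp [h0, h2]
  · right
    refine ⟨w 0 / w 2, w 1 / w 2, ?_, Subtype.ext (hmk.symm.trans
      ((Projectivization.mk_eq_mk_iff' _ _ _ _ _).2 ⟨w 2, ?_⟩))⟩
    · rw [div_pow, div_pow, div_add_div _ _ (pow_ne_zero _ h2) h2,
        div_eq_div_iff (mul_ne_zero (pow_ne_zero _ h2) h2) (pow_ne_zero _ h2)]
      linear_combination w 2 ^ (q + 1) * hw
    · ext i
      fin_cases i <;> simp [mul_div_cancel₀, h2]

theorem exists_rep_affinePoint (a b : k) (h : b ^ q + b = a ^ (q + 1)) :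
    ∃ c : k, c ≠ 0 ∧ (affinePoint a b h).1.rep = c • ![a, b, 1] :=
  let ⟨c, hc⟩ := Projectivization.exists_smul_eq_mk_rep k _ (affine_ne_zero a b)
  ⟨c, c.ne_zero, hc.symm⟩

theorem baseChange_affinePoint {L : Type*} [Field L] [Algebra L k] (a b : L)
    (h : b ^ q + b = a ^ (q + 1)) :
    baseChange k (affinePoint a b h) = affinePoint (algebraMap L k a) (algebraMap L k b)
      (by rw [← map_pow, ← map_pow, ← map_add, h]) := by
  obtain ⟨c, -, hrep⟩ := exists_rep_affinePoint a b h
  refine Subtype.ext ((Projectivization.mk_eq_mk_iff' _ _ _ _ _).2 ⟨algebraMap L k c, ?_⟩)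
  ext i
  rw [hrep]
  fin_cases i <;> simp

end Points

/-! ## Valuations at `O` and `Y_∞` -/

section Valuation

/-- The valuation `v` is trivial on the field of constants `k`. -/
def IsTrivialOn (k : Type*) {F : Type*} [Field k] [Field F] [Algebra k F]
    (v : AddValuation F (WithTop ℤ)) : Prop :=
  ∀ c : k, c ≠ 0 → v (algebraMap k F c) = 0

variable {k F : Type*} [Field k] [Field F] [Algebra k F] {v : AddValuation F (WithTop ℤ)}

theorem IsTrivialOn.map_algebraMap_nonneg (hv : IsTrivialOn k v) (c : k) :
    0 ≤ v (algebraMap k F c) := by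
  rcases eq_or_ne c 0 with rfl | hc
  · simp
  · exact (hv c hc).ge

theorem le_of_le_map_linearCombination (hv : IsTrivialOn k v) {ι : Type*} {e : ι → F} {n : ι → ℤ}
    (hn : ∀ s, v (e s) = n s) {l : ι →₀ k} (hl : Set.InjOn n l.support) {N : WithTop ℤ}
    (hN : N ≤ v (Finsupp.linearCombination k e l)) : ∀ s ∈ l.support, N ≤ n s := by
  classical
  by_contra! ⟨s₁, hs₁, hlt⟩
  obtain ⟨s, hs, hmin⟩ := l.support.exists_min_image n ⟨s₁, hs₁⟩
  have hterm : ∀ r ∈ l.support, v (l r • e r) = n r := fun r hr => by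
    rw [Algebra.smul_def, AddValuation.map_mul, hv _ (Finsupp.mem_support_iff.1 hr), hn, zero_add]
  have hrest : v (l s • e s) < v (∑ r ∈ l.support.erase s, l r • e r) := by
    rw [hterm s hs]
    refine AddValuation.map_lt_sum _ WithTop.coe_ne_top fun r hr => ?_
    have hr' := Finset.mem_of_mem_erase hr
    rw [hterm r hr', WithTop.coe_lt_coe]
    exact (hmin r hr').lt_of_ne fun h => Finset.ne_of_mem_erase hr (hl hr' hs h.symm)
  rw [Finsupp.linearCombination_apply, Finsupp.sum, ← Finset.add_sum_erase _ _ hs,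
    AddValuation.map_add_eq_of_lt_left _ hrest, hterm s hs] at hN
  exact (hlt.trans_le hN).not_ge (WithTop.coe_le_coe.2 (hmin s₁ hs₁))

theorem linearIndepOn_of_injOn_valuation (hv : IsTrivialOn k v) {ι : Type*} {e : ι → F}
    {n : ι → ℤ} (hn : ∀ s, v (e s) = n s) {S : Set ι} (hS : Set.InjOn n S) :
    LinearIndepOn k e S := by
  rw [linearIndepOn_iff]
  intro l hl h0
  have htop := le_of_le_map_linearCombination hv hn
    (hS.mono ((Finsupp.mem_supported k l).1 hl)) (N := ⊤) (by rw [h0, AddValuation.map_zero])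
  exact Finsupp.support_eq_empty.1 (Finset.eq_empty_of_forall_notMem fun s hs =>
    WithTop.coe_ne_top (top_le_iff.1 (htop s hs)))

theorem map_pow_mul_pow {x y : F} {a b : ℤ} (hx : v x = a) (hy : v y = b) (i j : ℕ) :
    v (x ^ i * y ^ j) = ((a * i + b * j : ℤ) : WithTop ℤ) := by
  rw [AddValuation.map_mul, AddValuation.map_pow, AddValuation.map_pow, hx, hy, ← WithTop.coe_nsmul,
    ← WithTop.coe_nsmul, ← WithTop.coe_add, nsmul_eq_mul, nsmul_eq_mul, mul_comm a, mul_comm b]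

theorem map_eq_of_pow_add_eq {q : ℕ} (hq : 1 < q) {X Y : F} (h : Y ^ q + Y = X ^ (q + 1))
    (hX : v X = (1 : ℤ)) (hY : 0 < v Y) : v Y = (q + 1 : ℤ) := by
  have hX' : v (X ^ (q + 1)) = (q + 1 : ℤ) := by
    rw [AddValuation.map_pow, hX, ← WithTop.coe_nsmul]
    simp
  have hY' : v Y ≠ ⊤ := fun htop => by
    rw [(AddValuation.top_iff v).1 htop, zero_pow (Nat.ne_zero_of_lt hq), add_zero] at h
    rw [← h, AddValuation.map_zero] at hX'
    exact WithTop.top_ne_coe hX'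
  have hlt : v Y < v (Y ^ q) := by
    obtain ⟨n, hn⟩ := WithTop.ne_top_iff_exists.1 hY'
    rw [← hn, ← WithTop.coe_zero, WithTop.coe_lt_coe] at hY
    rw [AddValuation.map_pow, ← hn, ← WithTop.coe_nsmul, WithTop.coe_lt_coe, nsmul_eq_mul]
    exact lt_mul_of_one_lt_left hY (by exact_mod_cast hq)
  rw [← hX', ← h, AddValuation.map_add_eq_of_lt_right _ hlt]

end Valuation

section LaurentBranch

variable (q : ℕ) (k : Type*) [Field k]

theorem exists_powerSeries_branch (hq : 1 < q) :
    ∃ Y : PowerSeries k, Y ^ q + Y = PowerSeries.X ^ (q + 1) ∧ PowerSeries.X ∣ Y := by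
  let p : Polynomial (PowerSeries k) :=
    Polynomial.X ^ q + (Polynomial.X - Polynomial.C (PowerSeries.X ^ (q + 1)))
  have hp : p.Monic := by
    refine (Polynomial.monic_X_pow q).add_of_left ?_
    rw [Polynomial.degree_X_sub_C, Polynomial.degree_X_pow]
    exact_mod_cast hq
  have hp0 : p.eval 0 ∈ Ideal.span {(PowerSeries.X : PowerSeries k)} := by
    simpa [p, Nat.ne_zero_of_lt hq] using
      Ideal.mem_span_singleton.2 (dvd_pow_self PowerSeries.X q.succ_ne_zero)
  have hp1 : IsUnit (Ideal.Quotient.mk (Ideal.span {(PowerSeries.X : PowerSeries k)})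
      (p.derivative.eval 0)) := by
    rw [Polynomial.derivative_add, Polynomial.derivative_X_pow, Polynomial.derivative_X_sub_C]
    simp [Nat.sub_ne_zero_of_lt hq]
  obtain ⟨Y, hY, hY0⟩ := HenselianRing.is_henselian p hp 0 hp0 hp1
  rw [sub_zero, Ideal.mem_span_singleton] at hY0
  refine ⟨Y, ?_, hY0⟩
  simp only [p, Polynomial.IsRoot.def, Polynomial.eval_add, Polynomial.eval_pow, Polynomial.eval_X,
    Polynomial.eval_sub, Polynomial.eval_C] at hY
  linear_combination hY

theorem isTrivialOn_addVal : IsTrivialOn k (HahnSeries.addVal ℤ k) := fun c hc => by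
  have h : algebraMap k (LaurentSeries k) c = HahnSeries.single 0 c := by
    rw [HahnSeries.algebraMap_apply']
    exact HahnSeries.ofPowerSeries_C c
  rw [h, HahnSeries.addVal_apply, HahnSeries.orderTop_single hc]
  rfl

theorem addVal_ofPowerSeries_X :
    HahnSeries.addVal ℤ k (HahnSeries.ofPowerSeries ℤ k PowerSeries.X) = (1 : ℤ) := by
  rw [HahnSeries.ofPowerSeries_X, HahnSeries.addVal_apply, HahnSeries.orderTop_single one_ne_zero]

theorem addVal_ofPowerSeries_nonneg (p : PowerSeries k) :
    0 ≤ HahnSeries.addVal ℤ k (HahnSeries.ofPowerSeries ℤ k p) := by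
  rw [HahnSeries.addVal_apply]
  refine HahnSeries.le_orderTop_iff_forall.2 fun j hj => ?_
  rw [PowerSeries.coeff_coe, if_pos (by exact_mod_cast hj)]

theorem exists_laurentSeries_branch (hq : 1 < q) :
    ∃ X Y : LaurentSeries k, Y ^ q + Y = X ^ (q + 1) ∧ HahnSeries.addVal ℤ k X = (1 : ℤ) ∧
      HahnSeries.addVal ℤ k Y = (q + 1 : ℤ) := by
  obtain ⟨Y, hY, Z, rfl⟩ := exists_powerSeries_branch q k hq
  have h := congrArg (HahnSeries.ofPowerSeries ℤ k) hY
  rw [map_add, map_pow, map_pow] at h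
  have hX := addVal_ofPowerSeries_X k
  refine ⟨_, _, h, hX, map_eq_of_pow_add_eq hq h hX ?_⟩
  rw [map_mul, AddValuation.map_mul, hX]
  exact lt_of_lt_of_le (WithTop.coe_lt_coe.2 one_pos)
    (le_add_of_nonneg_right (addVal_ofPowerSeries_nonneg k Z))

end LaurentBranch

section Places

theorem injOn_weight_origin (q : ℕ) :
    Set.InjOn (fun s : ℕ × ℕ => (1 * s.1 + (q + 1) * s.2 : ℤ)) {s | s.1 ≤ q} := by
  rintro ⟨i, j⟩ hi ⟨i', j'⟩ hi' h
  have hmod (n : ℕ) {r : ℕ} (hr : r ≤ q) : (r + (q + 1) * n) / (q + 1) = n := by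
    rw [Nat.add_mul_div_left _ _ q.succ_pos, Nat.div_eq_of_lt (Nat.lt_succ_of_le hr), zero_add]
  have h' : i + (q + 1) * j = i' + (q + 1) * j' := by
    simp only [one_mul] at h
    exact_mod_cast h
  obtain rfl : j = j' := by rw [← hmod j hi, h', hmod j' hi']
  simpa using h'

theorem injOn_weight_infinity (q : ℕ) :
    Set.InjOn (fun s : ℕ × ℕ => (-q * s.1 + -(q + 1) * s.2 : ℤ)) {s | s.1 ≤ q} := by
  rintro ⟨i, j⟩ hi ⟨i', j'⟩ hi' h
  have h' : (i, i' + j') = (i', i + j) := injOn_weight_origin q (show (i, i' + j') ∈ _ from hi)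
    (show (i', i + j) ∈ _ from hi') (by
    push_cast
    linear_combination h)
  simp only [Prod.mk.injEq] at h' ⊢
  omega

variable {q : ℕ} {k : Type*} [Field k]

theorem coordLift_injective {F : Type*} [Field F] [Algebra k F] {v : AddValuation F (WithTop ℤ)}
    (hv : IsTrivialOn k v) {X Y : F} (h : Y ^ q + Y = X ^ (q + 1)) {a b : ℤ} (ha : v X = a)
    (hb : v Y = b) (hab : Set.InjOn (fun s : ℕ × ℕ => a * s.1 + b * s.2) {s | s.1 ≤ q}) :
    Function.Injective (coordLift (k := k) X Y h) := by
  rw [injective_iff_map_eq_zero]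
  intro g hg
  obtain ⟨l, hl, rfl⟩ := (Finsupp.mem_span_image_iff_linearCombination k).1
    (mem_span_coordMonomial g)
  rw [← AlgHom.coe_toLinearMap, Finsupp.apply_linearCombination] at hg
  have hindep := linearIndepOn_of_injOn_valuation hv
    (e := (coordLift (k := k) X Y h).toLinearMap ∘ coordMonomial) (fun s => by
      simpa [coordLift_coordMonomial] using map_pow_mul_pow ha hb s.1 s.2) hab
  rw [linearIndepOn_iff.1 hindep l hl hg, map_zero]

variable [hq : Fact (1 < q)]

theorem exists_addValuation_of_point {F : Type*} [Field F] [Algebra k F]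
    {v : AddValuation F (WithTop ℤ)} (hv : IsTrivialOn k v) {X Y : F}
    (h : Y ^ q + Y = X ^ (q + 1)) {a b : ℤ} (ha : v X = a) (hb : v Y = b)
    (hab : Set.InjOn (fun s : ℕ × ℕ => a * s.1 + b * s.2) {s | s.1 ≤ q}) :
    ∃ v' : AddValuation (FunctionField q k) (WithTop ℤ),
      IsTrivialOn k v' ∧ v' xFun = a ∧ v' yFun = b := by
  let ψ : FunctionField q k →+* F :=
    IsFractionRing.lift (g := (coordLift (k := k) X Y h : CoordRing q k →+* F))
      (coordLift_injective hv h ha hb hab)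
  have hψ (r : CoordRing q k) : ψ (algebraMap _ _ r) = coordLift (k := k) X Y h r :=
    IsFractionRing.lift_algebraMap _ r
  refine ⟨v.comap ψ, fun c hc => ?_, ?_, ?_⟩
  · change v (ψ _) = 0
    rw [IsScalarTower.algebraMap_apply k (CoordRing q k), hψ, AlgHom.commutes, hv c hc]
  · exact (congrArg v ((hψ coordX).trans (coordLift_coordX X Y h))).trans ha
  · exact (congrArg v ((hψ coordY).trans (coordLift_coordY X Y h))).trans hb

variable (q k)

theorem exists_addValuation_origin :
    ∃ v : AddValuation (FunctionField q k) (WithTop ℤ),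
      IsTrivialOn k v ∧ v xFun = (1 : ℤ) ∧ v yFun = (q + 1 : ℤ) := by
  obtain ⟨X, Y, h, hX, hY⟩ := exists_laurentSeries_branch q k hq.out
  exact exists_addValuation_of_point (isTrivialOn_addVal k) h hX hY (injOn_weight_origin q)

-- The involution `(X₁ : X₂ : X₃) ↦ (X₁ : X₃ : X₂)` of the curve exchanges `O` and `Y_∞`, so
-- that `(X / Y, 1 / Y)` parametrizes the branch at infinity.
theorem exists_addValuation_infinity :
    ∃ v : AddValuation (FunctionField q k) (WithTop ℤ),
      IsTrivialOn k v ∧ v xFun = (-q : ℤ) ∧ v yFun = (-(q + 1) : ℤ) := by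
  obtain ⟨X, Y, h, hX, hY⟩ := exists_laurentSeries_branch q k hq.out
  have hY0 : Y ≠ 0 := by
    rintro rfl
    exact WithTop.top_ne_coe ((AddValuation.map_zero _).symm.trans hY)
  have hinv : HahnSeries.addVal ℤ k Y⁻¹ = (-(q + 1) : ℤ) := by
    rw [AddValuation.map_inv, hY]
    rfl
  have hcurve : Y⁻¹ ^ q + Y⁻¹ = (X * Y⁻¹) ^ (q + 1) := by
    rw [mul_pow, ← h, inv_pow, inv_pow]
    field_simp
    ring
  have hdiv : HahnSeries.addVal ℤ k (X * Y⁻¹) = (-q : ℤ) := by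
    rw [AddValuation.map_mul, hX, hinv, ← WithTop.coe_add]
    congr 1
    ring
  exact exists_addValuation_of_point (isTrivialOn_addVal k) hcurve hdiv hinv
    (injOn_weight_infinity q)

end Places

/-! ## Values and uniformizers -/

section LocalRing

variable {q : ℕ} {k : Type*} [Field k]

/-- The coordinates `X_i / X_l` of a point in the affine chart `X_l ≠ 0`. -/
def chartVal (P : curve q k) (l i : Fin 3) : k := P.1.rep i / P.1.rep l

theorem eval_rep_eq_mul_eval_chartVal {n : ℕ} {A : MvPolynomial (Fin 3) k} (hA : A.IsHomogeneous n)
    {P : curve q k} {l : Fin 3} (hl : P.1.rep l ≠ 0) :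
    MvPolynomial.eval P.1.rep A = P.1.rep l ^ n * MvPolynomial.eval (chartVal P l) A := by
  rw [← eval_smul_of_isHomogeneous hA]
  congr 2
  ext i
  rw [Pi.smul_apply, smul_eq_mul, chartVal, mul_div_cancel₀ _ hl]

theorem affinePoint_rep_two_ne_zero (a b : k) (h : b ^ q + b = a ^ (q + 1)) :
    (affinePoint a b h).1.rep 2 ≠ 0 := by
  obtain ⟨c, hc, hrep⟩ := exists_rep_affinePoint a b h
  simpa [hrep] using hc

theorem chartVal_affinePoint (a b : k) (h : b ^ q + b = a ^ (q + 1)) :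
    chartVal (affinePoint a b h) 2 = ![a, b, 1] := by
  obtain ⟨c, hc, hrep⟩ := exists_rep_affinePoint a b h
  ext i
  rw [chartVal, hrep]
  fin_cases i <;> simp [hc]

theorem exists_rep_infinityCurvePoint (hq : 1 < q) :
    ∃ c : k, c ≠ 0 ∧ (infinityCurvePoint hq : curve q k).1.rep = c • ![0, 1, 0] :=
  let ⟨c, hc⟩ := Projectivization.exists_smul_eq_mk_rep k ![0, 1, 0] _
  ⟨c, c.ne_zero, hc.symm⟩

theorem infinityCurvePoint_rep_one_ne_zero (hq : 1 < q) :
    (infinityCurvePoint hq : curve q k).1.rep 1 ≠ 0 := by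
  obtain ⟨c, hc, hrep⟩ := exists_rep_infinityCurvePoint (k := k) hq
  simpa [hrep] using hc

theorem chartVal_infinityCurvePoint (hq : 1 < q) :
    chartVal (infinityCurvePoint hq : curve q k) 1 = ![0, 1, 0] := by
  obtain ⟨c, hc, hrep⟩ := exists_rep_infinityCurvePoint (k := k) hq
  ext i
  rw [chartVal, hrep]
  fin_cases i <;> simp [hc]

theorem coordLift_aeval (a b : k) (h : b ^ q + b = a ^ (q + 1)) (A : MvPolynomial (Fin 3) k) :
    coordLift (k := k) a b h (MvPolynomial.aeval ![coordX, coordY, 1] A) =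
      MvPolynomial.eval ![a, b, 1] A := by
  have hcomp : (coordLift (k := k) a b h).comp (MvPolynomial.aeval ![coordX, coordY, 1]) =
      MvPolynomial.aeval ![a, b, 1] := by
    ext i
    fin_cases i <;> simp
  exact DFunLike.congr_fun hcomp A

theorem dehom_eq_algebraMap (A : MvPolynomial (Fin 3) k) :
    dehom (q := q) A = algebraMap (CoordRing q k) (FunctionField q k)
      (MvPolynomial.aeval ![coordX, coordY, 1] A) := by
  rw [← MvPolynomial.aeval_algebraMap_apply, dehom]
  congr 2
  ext i
  fin_cases i <;> simp [xFun, yFun, coordX, coordY]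

section Valuation

variable {F σ : Type*} [Field F] [Algebra k F] {v : AddValuation F (WithTop ℤ)}
  {e : σ → F} {w : σ → k}

theorem map_aeval_sub_pos (hv : IsTrivialOn k v) (he : ∀ i, 0 < v (e i - algebraMap k F (w i)))
    (A : MvPolynomial σ k) :
    0 < v (MvPolynomial.aeval e A - algebraMap k F (MvPolynomial.eval w A)) := by
  induction A using MvPolynomial.induction_on with
  | C a => simp
  | add p r hp hr =>
    rw [map_add, map_add, map_add, add_sub_add_comm]
    exact AddValuation.map_lt_add v hp hr
  | mul_X p i hp =>
    have hi : 0 ≤ v (e i) := by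
      simpa using AddValuation.map_le_add v (he i).le (hv.map_algebraMap_nonneg (w i))
    have hsplit : MvPolynomial.aeval e (p * .X i) -
          algebraMap k F (MvPolynomial.eval w (p * .X i)) =
        (MvPolynomial.aeval e p - algebraMap k F (MvPolynomial.eval w p)) * e i +
          algebraMap k F (MvPolynomial.eval w p) * (e i - algebraMap k F (w i)) := by
      simp only [map_mul, MvPolynomial.aeval_X, MvPolynomial.eval_X]
      ring
    rw [hsplit]
    refine AddValuation.map_lt_add v ?_ ?_ <;> rw [AddValuation.map_mul]
    · exact hp.trans_le (le_add_of_nonneg_right hi)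
    · exact (he i).trans_le (le_add_of_nonneg_left (hv.map_algebraMap_nonneg _))

theorem map_aeval_eq_zero (hv : IsTrivialOn k v) (he : ∀ i, 0 < v (e i - algebraMap k F (w i)))
    {A : MvPolynomial σ k} (hA : MvPolynomial.eval w A ≠ 0) : v (MvPolynomial.aeval e A) = 0 := by
  have hlt := (hv _ hA).symm ▸ map_aeval_sub_pos hv he A
  simpa [hv _ hA] using AddValuation.map_add_eq_of_lt_left v hlt

theorem map_aeval_nonneg (hv : IsTrivialOn k v) (he : ∀ i, 0 < v (e i - algebraMap k F (w i)))
    (A : MvPolynomial σ k) : 0 ≤ v (MvPolynomial.aeval e A) := by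
  simpa using AddValuation.map_le_add v (map_aeval_sub_pos hv he A).le
    (hv.map_algebraMap_nonneg (MvPolynomial.eval w A))

end Valuation

variable [hq : Fact (1 < q)]

theorem dehom_X_ne_zero (i : Fin 3) :
    dehom (q := q) (MvPolynomial.X i : MvPolynomial (Fin 3) k) ≠ 0 := by
  fin_cases i <;> simp [dehom, xFun_ne_zero, yFun_ne_zero]

variable (q k) in
/-- The coordinate functions `X_i / X_l` of the affine chart `X_l ≠ 0`. -/
def chartFun (l i : Fin 3) : FunctionField q k :=
  dehom (MvPolynomial.X i) / dehom (MvPolynomial.X l)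

theorem chartFun_two : chartFun q k 2 = ![xFun, yFun, 1] := by
  ext i
  fin_cases i <;> simp [chartFun, dehom]

theorem chartFun_one : chartFun q k 1 = ![xFun / yFun, 1, yFun⁻¹] := by
  ext i
  fin_cases i <;> simp [chartFun, dehom, yFun_ne_zero]

theorem dehom_eq_mul_aeval_chartFun {n : ℕ} {A : MvPolynomial (Fin 3) k} (hA : A.IsHomogeneous n)
    (l : Fin 3) :
    dehom (q := q) A = dehom (q := q) (MvPolynomial.X l : MvPolynomial (Fin 3) k) ^ n *
      MvPolynomial.aeval (chartFun q k l) A := by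
  rw [← aeval_smul_of_isHomogeneous hA]
  conv_lhs => rw [dehom]
  congr 2
  ext i
  rw [Pi.smul_apply, smul_eq_mul, chartFun, mul_div_cancel₀ _ (dehom_X_ne_zero l)]
  simp [dehom]

theorem dehom_div_dehom_eq {n : ℕ} {A B : MvPolynomial (Fin 3) k} (hA : A.IsHomogeneous n)
    (hB : B.IsHomogeneous n) (l : Fin 3) :
    dehom (q := q) A / dehom B =
      MvPolynomial.aeval (chartFun q k l) A / MvPolynomial.aeval (chartFun q k l) B := by
  rw [dehom_eq_mul_aeval_chartFun hA l, dehom_eq_mul_aeval_chartFun hB l,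
    mul_div_mul_left _ _ (pow_ne_zero _ (dehom_X_ne_zero l))]

/-- The valuation `v` is centered at the point `P`: in some affine chart containing `P`, the
coordinate functions take positive values after subtracting the coordinates of `P`. -/
def IsCenteredAt (v : AddValuation (FunctionField q k) (WithTop ℤ)) (P : curve q k) : Prop :=
  ∃ l : Fin 3, P.1.rep l ≠ 0 ∧ ∀ i, 0 < v (chartFun q k l i - algebraMap k _ (chartVal P l i))

variable {v : AddValuation (FunctionField q k) (WithTop ℤ)}

theorem IsRegularAt.map_nonneg {f : FunctionField q k} {P : curve q k} (hf : IsRegularAt f P)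
    (hv : IsTrivialOn k v) (hP : IsCenteredAt v P) : 0 ≤ v f := by
  obtain ⟨c, n, A, B, hA, hB, -, hBP, rfl, -⟩ := hf
  obtain ⟨l, hl, he⟩ := hP
  rw [eval_rep_eq_mul_eval_chartVal hB hl] at hBP
  rw [dehom_div_dehom_eq hA hB l, AddValuation.map_div,
    map_aeval_eq_zero hv he (right_ne_zero_of_mul hBP), sub_zero]
  exact map_aeval_nonneg hv he A

theorem IsCenteredAt.dehom_ne_zero {P : curve q k} (hP : IsCenteredAt v P) (hv : IsTrivialOn k v)
    {n : ℕ} {A : MvPolynomial (Fin 3) k} (hA : A.IsHomogeneous n)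
    (hAP : MvPolynomial.eval P.1.rep A ≠ 0) : dehom (q := q) A ≠ 0 := by
  obtain ⟨l, hl, he⟩ := hP
  rw [eval_rep_eq_mul_eval_chartVal hA hl] at hAP
  rw [dehom_eq_mul_aeval_chartFun hA l]
  refine mul_ne_zero (pow_ne_zero _ (dehom_X_ne_zero l)) fun h => ?_
  have h0 := map_aeval_eq_zero hv he (right_ne_zero_of_mul hAP)
  rw [h, AddValuation.map_zero] at h0
  exact WithTop.top_ne_zero h0

theorem isCenteredAt_infinityCurvePoint (hx : v xFun = (-q : ℤ)) (hy : v yFun = (-(q + 1) : ℤ)) :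
    IsCenteredAt v (infinityCurvePoint hq.out : curve q k) := by
  refine ⟨1, infinityCurvePoint_rep_one_ne_zero hq.out, fun i => ?_⟩
  rw [chartFun_one, chartVal_infinityCurvePoint]
  fin_cases i
  · simp only [Fin.zero_eta, Matrix.cons_val_zero, map_zero, sub_zero]
    rw [AddValuation.map_div, hx, hy, ← WithTop.LinearOrderedAddCommGroup.coe_sub]
    exact WithTop.coe_lt_coe.2 (by linarith)
  · simp
  · simp only [Fin.reduceFinMk, Matrix.cons_val, map_zero, sub_zero]
    rw [AddValuation.map_inv, hy, ← WithTop.LinearOrderedAddCommGroup.coe_neg]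
    exact WithTop.coe_lt_coe.2 (by linarith)

theorem isCenteredAt_origin (hx : v xFun = (1 : ℤ)) (hy : v yFun = (q + 1 : ℤ))
    (h : (0 : k) ^ q + 0 = 0 ^ (q + 1)) : IsCenteredAt v (affinePoint 0 0 h) := by
  refine ⟨2, affinePoint_rep_two_ne_zero 0 0 h, fun i => ?_⟩
  rw [chartFun_two, chartVal_affinePoint]
  fin_cases i
  · simp [hx]
  · simp only [Fin.mk_one, Matrix.cons_val_one, Matrix.cons_val_zero, map_zero, sub_zero, hy]
    exact WithTop.coe_lt_coe.2 (by linarith)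
  · simp

theorem dehom_ne_zero_of_eval_ne_zero {n : ℕ} {A : MvPolynomial (Fin 3) k} (hA : A.IsHomogeneous n)
    {P : curve q k} (hP : MvPolynomial.eval P.1.rep A ≠ 0) : dehom (q := q) A ≠ 0 := by
  rcases eq_infinityCurvePoint_or_eq_affinePoint hq.out P with rfl | ⟨a, b, h, rfl⟩
  · obtain ⟨v, hv, hx, hy⟩ := exists_addValuation_infinity q k
    exact (isCenteredAt_infinityCurvePoint hx hy).dehom_ne_zero hv hA hP
  · rw [eval_rep_eq_mul_eval_chartVal hA (affinePoint_rep_two_ne_zero a b h),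
      chartVal_affinePoint] at hP
    rw [dehom_eq_algebraMap, Ne, FaithfulSMul.algebraMap_eq_zero_iff]
    intro h0
    rw [← coordLift_aeval a b h, h0, map_zero, mul_zero] at hP
    exact hP rfl

theorem HasValueAt.unique {f : FunctionField q k} {P : curve q k} {c d : k}
    (hc : HasValueAt f P c) (hd : HasValueAt f P d) : c = d := by
  obtain ⟨n, A, B, hA, hB, hB0, hBP, rfl, rfl⟩ := hc
  obtain ⟨n', A', B', hA', hB', hB0', hBP', he, rfl⟩ := hd
  rw [div_eq_div_iff hBP hBP']
  by_contra hne
  refine dehom_ne_zero_of_eval_ne_zero (P := P)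
    ((hA.mul hB').sub (add_comm n' n ▸ hA'.mul hB)) ?_ ?_
  · rw [map_sub, map_mul, map_mul]
    exact sub_ne_zero.2 hne
  · rw [map_sub, map_mul, map_mul, sub_eq_zero]
    exact (div_eq_div_iff hB0 hB0').1 he

theorem HasValueAt.inv {f : FunctionField q k} {P : curve q k} {c : k}
    (hf : HasValueAt f P c) (hc : c ≠ 0) : HasValueAt f⁻¹ P c⁻¹ := by
  obtain ⟨n, A, B, hA, hB, -, -, rfl, rfl⟩ := hf
  have hAP := (div_ne_zero_iff.1 hc).1
  exact ⟨n, B, A, hB, hA, dehom_ne_zero_of_eval_ne_zero hA hAP, hAP, inv_div _ _,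
    (inv_div _ _).symm⟩

theorem HasValueAt.pow {f : FunctionField q k} {P : curve q k} {c : k}
    (hf : HasValueAt f P c) (n : ℕ) : HasValueAt (f ^ n) P (c ^ n) := by
  induction n with
  | zero => simpa using HasValueAt.const P 1
  | succ n ih => rw [pow_succ, pow_succ]; exact ih.mul hf

theorem HasValueAt.sum {ι : Type*} (s : Finset ι) {f : ι → FunctionField q k} {P : curve q k}
    {c : ι → k} (hf : ∀ i ∈ s, HasValueAt (f i) P (c i)) :
    HasValueAt (∑ i ∈ s, f i) P (∑ i ∈ s, c i) := by
  classical
  induction s using Finset.induction_on with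
  | empty => simpa using HasValueAt.const P 0
  | insert a s ha ih =>
    rw [Finset.sum_insert ha, Finset.sum_insert ha]
    exact (hf a (Finset.mem_insert_self a s)).add
      (ih fun i hi => hf i (Finset.mem_insert_of_mem hi))

theorem HasValueAt.ne_zero {f : FunctionField q k} {P : curve q k} {c : k}
    (hf : HasValueAt f P c) (hc : c ≠ 0) : f ≠ 0 := by
  rintro rfl
  exact hc (hf.unique (by simpa using HasValueAt.const P 0))

theorem HasValueAt.exists_eq_mul {f g w : FunctionField q k} {P : curve q k} {c : k}
    (hg : HasValueAt g P c) (hc : c ≠ 0) (h : f * g = w) : ∃ r, IsRegularAt r P ∧ f = r * w :=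
  ⟨g⁻¹, ⟨_, hg.inv hc⟩, by rw [← h, mul_comm f, inv_mul_cancel_left₀ (hg.ne_zero hc)]⟩

theorem IsRegularAt.zero (P : curve q k) : IsRegularAt (0 : FunctionField q k) P := by
  simpa using IsRegularAt.const P 0

theorem IsRegularAt.one (P : curve q k) : IsRegularAt (1 : FunctionField q k) P := by
  simpa using IsRegularAt.const P 1

theorem hasValueAt_chartFun {P : curve q k} {l : Fin 3} (hl : P.1.rep l ≠ 0) (i : Fin 3) :
    HasValueAt (chartFun q k l i) P (chartVal P l i) :=
  ⟨1, .X i, .X l, MvPolynomial.isHomogeneous_X _ _, MvPolynomial.isHomogeneous_X _ _,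
    dehom_X_ne_zero l, by simpa using hl, rfl, by simp [chartVal]⟩

theorem hasValueAt_xFun (a b : k) (h : b ^ q + b = a ^ (q + 1)) :
    HasValueAt xFun (affinePoint a b h) a := by
  simpa [chartFun_two, chartVal_affinePoint] using
    hasValueAt_chartFun (affinePoint_rep_two_ne_zero a b h) 0

theorem hasValueAt_yFun (a b : k) (h : b ^ q + b = a ^ (q + 1)) :
    HasValueAt yFun (affinePoint a b h) b := by
  simpa [chartFun_two, chartVal_affinePoint] using
    hasValueAt_chartFun (affinePoint_rep_two_ne_zero a b h) 1

theorem hasValueAt_xFun_div_yFun :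
    HasValueAt (xFun / yFun : FunctionField q k) (infinityCurvePoint hq.out) 0 := by
  simpa [chartFun_one, chartVal_infinityCurvePoint] using
    hasValueAt_chartFun (infinityCurvePoint_rep_one_ne_zero (k := k) hq.out) 0

theorem hasValueAt_inv_yFun :
    HasValueAt (yFun⁻¹ : FunctionField q k) (infinityCurvePoint hq.out) 0 := by
  simpa [chartFun_one, chartVal_infinityCurvePoint] using
    hasValueAt_chartFun (infinityCurvePoint_rep_one_ne_zero (k := k) hq.out) 2

end LocalRing

section Uniformizers

variable {q : ℕ} [hq : Fact (1 < q)] {k : Type*} [Field k]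

theorem exists_aeval_sub_eq_mul {σ : Type*} {P : curve q k} {e : σ → FunctionField q k} {w : σ → k}
    (he : ∀ i, IsRegularAt (e i) P) {t : FunctionField q k}
    (ht : ∀ i, ∃ r, IsRegularAt r P ∧ e i - algebraMap k _ (w i) = r * t) (A : MvPolynomial σ k) :
    ∃ r, IsRegularAt r P ∧
      MvPolynomial.aeval e A - algebraMap k _ (MvPolynomial.eval w A) = r * t := by
  induction A using MvPolynomial.induction_on with
  | C a => exact ⟨0, .zero P, by simp⟩
  | add p r hp hr =>
    obtain ⟨s, hs, hps⟩ := hp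
    obtain ⟨s', hs', hrs⟩ := hr
    refine ⟨s + s', hs.add hs', ?_⟩
    rw [map_add, map_add, map_add]
    linear_combination hps + hrs
  | mul_X p i hp =>
    obtain ⟨s, hs, hps⟩ := hp
    obtain ⟨r, hr, hri⟩ := ht i
    refine ⟨s * e i + algebraMap k _ (MvPolynomial.eval w p) * r,
      (hs.mul (he i)).add ((IsRegularAt.const P _).mul hr), ?_⟩
    rw [map_mul, map_mul, map_mul, MvPolynomial.aeval_X, MvPolynomial.eval_X]
    linear_combination e i * hps + algebraMap k _ (MvPolynomial.eval w p) * hri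

theorem isUniformizerAt_of_chart {P : curve q k} {l : Fin 3} (hl : P.1.rep l ≠ 0)
    {t : FunctionField q k} (ht : HasValueAt t P 0)
    (h : ∀ i, ∃ r, IsRegularAt r P ∧ chartFun q k l i - algebraMap k _ (chartVal P l i) = r * t) :
    IsUniformizerAt t P := by
  refine ⟨ht, ?_⟩
  rintro s ⟨n, A, B, hA, hB, hB0, hBP, rfl, h0⟩
  have hA0 : MvPolynomial.eval (chartVal P l) A = 0 := by
    have hAP := (div_eq_zero_iff.1 h0).resolve_right hBP
    rw [eval_rep_eq_mul_eval_chartVal hA hl] at hAP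
    exact (mul_eq_zero.1 hAP).resolve_left (pow_ne_zero _ hl)
  obtain ⟨r, hr, hAr⟩ := exists_aeval_sub_eq_mul (fun i => ⟨_, hasValueAt_chartFun hl i⟩) h A
  rw [hA0, map_zero, sub_zero] at hAr
  have hBinv : IsRegularAt (MvPolynomial.aeval (chartFun q k l) B)⁻¹ P := by
    refine ⟨_, n, .X l ^ n, B, MvPolynomial.isHomogeneous_X_pow _ _, hB, hB0, hBP, ?_, rfl⟩
    rw [dehom_eq_mul_aeval_chartFun hB l, map_pow,
      div_mul_cancel_left₀ (pow_ne_zero _ (dehom_X_ne_zero l))]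
  refine ⟨r * (MvPolynomial.aeval (chartFun q k l) B)⁻¹, hr.mul hBinv, ?_⟩
  rw [dehom_div_dehom_eq hA hB l, hAr, div_eq_mul_inv, mul_right_comm]

theorem exists_yFun_sub_eq_mul (hqk : (q : k) = 0) (a b : k) (h : b ^ q + b = a ^ (q + 1)) :
    ∃ r, IsRegularAt r (affinePoint a b h) ∧
      yFun - algebraMap k (FunctionField q k) b = r * (xFun - algebraMap k _ a) := by
  let P := affinePoint a b h
  let S : FunctionField q k :=
    ∑ i ∈ Finset.range q, yFun ^ i * algebraMap k _ b ^ (q - 1 - i) + algebraMap k _ 1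
  let T : FunctionField q k := ∑ i ∈ Finset.range (q + 1), xFun ^ i * algebraMap k _ a ^ (q - i)
  have hS : HasValueAt S P 1 := by
    have hS' := (HasValueAt.sum (Finset.range q) fun i _ => ((hasValueAt_yFun a b h).pow i).mul
      ((HasValueAt.const P b).pow (q - 1 - i))).add (.const P 1)
    rwa [geom_sum₂_self, hqk, zero_mul, zero_add] at hS'
  have hT : IsRegularAt T P := ⟨_, HasValueAt.sum _ fun i _ => ((hasValueAt_xFun a b h).pow i).mul
    ((HasValueAt.const P a).pow (q - i))⟩
  have hST : (yFun - algebraMap k _ b) * S = T * (xFun - algebraMap k _ a) := by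
    have hy := (Commute.all (yFun : FunctionField q k) (algebraMap k _ b)).geom_sum₂_mul q
    have hx := (Commute.all (xFun : FunctionField q k) (algebraMap k _ a)).geom_sum₂_mul (q + 1)
    have hab := congrArg (algebraMap k (FunctionField q k)) h
    rw [map_add, map_pow, map_pow] at hab
    rw [Nat.add_sub_cancel] at hx
    rw [show S = _ + _ from rfl, show T = _ from rfl, map_one]
    linear_combination hy - hx + yFun_pow_add_yFun (q := q) (k := k) - hab
  obtain ⟨r, hr, hrT⟩ := hS.exists_eq_mul one_ne_zero hST
  exact ⟨r * T, hr.mul hT, by rw [hrT, mul_assoc]⟩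

theorem isUniformizerAt_xFun_sub (hqk : (q : k) = 0) (a b : k) (h : b ^ q + b = a ^ (q + 1)) :
    IsUniformizerAt (xFun - algebraMap k _ a) (affinePoint a b h) := by
  have ht : HasValueAt (xFun - algebraMap k (FunctionField q k) a) (affinePoint a b h) 0 := by
    simpa [sub_eq_add_neg] using (hasValueAt_xFun a b h).add (.const _ (-a))
  refine isUniformizerAt_of_chart (affinePoint_rep_two_ne_zero a b h) ht fun i => ?_
  rw [chartFun_two, chartVal_affinePoint]
  fin_cases i
  · exact ⟨1, .one _, by simp⟩
  · exact exists_yFun_sub_eq_mul hqk a b h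
  · exact ⟨0, .zero _, by simp⟩

theorem exists_yFun_eq_mul_xFun_pow (h : (0 : k) ^ q + 0 = 0 ^ (q + 1)) :
    ∃ r : FunctionField q k, IsRegularAt r (affinePoint 0 0 h) ∧ yFun = r * xFun ^ (q + 1) := by
  have hS := ((hasValueAt_yFun 0 0 h).pow (q - 1)).add (.const _ 1)
  rw [zero_pow (Nat.sub_ne_zero_of_lt hq.out), zero_add] at hS
  refine hS.exists_eq_mul one_ne_zero ?_
  rw [mul_add, mul_pow_sub_one (Nat.ne_zero_of_lt hq.out), map_one, mul_one, yFun_pow_add_yFun]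

theorem exists_inv_yFun_eq_mul_pow :
    ∃ r : FunctionField q k, IsRegularAt r (infinityCurvePoint hq.out) ∧
      yFun⁻¹ = r * (xFun / yFun) ^ (q + 1) := by
  have hS := ((hasValueAt_inv_yFun (q := q) (k := k)).pow (q - 1)).add (.const _ 1)
  rw [zero_pow (Nat.sub_ne_zero_of_lt hq.out), zero_add] at hS
  refine hS.exists_eq_mul one_ne_zero ?_
  have hy : (yFun : FunctionField q k) ≠ 0 := yFun_ne_zero
  rw [mul_add, mul_pow_sub_one (Nat.ne_zero_of_lt hq.out), map_one, mul_one, div_pow,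
    ← yFun_pow_add_yFun, inv_pow]
  field_simp
  ring

theorem isUniformizerAt_xFun_div_yFun :
    IsUniformizerAt (xFun / yFun : FunctionField q k) (infinityCurvePoint hq.out) := by
  have ht := hasValueAt_xFun_div_yFun (q := q) (k := k)
  refine isUniformizerAt_of_chart (infinityCurvePoint_rep_one_ne_zero hq.out) ht fun i => ?_
  rw [chartFun_one, chartVal_infinityCurvePoint]
  fin_cases i
  · exact ⟨1, .one _, by simp⟩
  · exact ⟨0, .zero _, by simp⟩
  · obtain ⟨r, hr, he⟩ := exists_inv_yFun_eq_mul_pow (q := q) (k := k)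
    refine ⟨r * (xFun / yFun) ^ q, hr.mul ⟨_, ht.pow q⟩, ?_⟩
    simp only [Fin.reduceFinMk, Matrix.cons_val, map_zero, sub_zero]
    rw [he, pow_succ, mul_assoc]

end Uniformizers

/-! ## Rationality over a finite field -/

section FiniteField

theorem exists_algebraMap_eq_of_pow_card {L : Type*} [Field L] [Fintype L] {k : Type*} [Field k]
    [Algebra L k] {a : k} (ha : a ^ Fintype.card L = a) : ∃ c : L, algebraMap L k c = a := by
  have h1 : 1 < Fintype.card L := Fintype.one_lt_card
  have hsplits : (Polynomial.X ^ Fintype.card L - Polynomial.X : Polynomial L).Splits := by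
    rw [Polynomial.splits_iff_card_roots, FiniteField.roots_X_pow_card_sub_X,
      FiniteField.X_pow_card_sub_X_natDegree_eq L h1]
    rfl
  exact hsplits.mem_range_of_isRoot (FiniteField.X_pow_card_sub_X_ne_zero L h1) (by simp [ha])

variable {q : ℕ} {L : Type*} [Field L] [Fintype L]

theorem natCast_eq_zero_of_card (hL : Fintype.card L = q ^ 2) (k : Type*) [Field k] [Algebra L k] :
    (q : k) = 0 := by
  have h := FiniteField.cast_card_eq_zero L
  rw [hL, Nat.cast_pow, pow_eq_zero_iff two_ne_zero] at h
  rw [← map_natCast (algebraMap L k), h, map_zero]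

theorem add_pow_of_card (hL : Fintype.card L = q ^ 2) {k : Type*} [Field k] [Algebra L k]
    (a b : k) : (a + b) ^ q = a ^ q + b ^ q := by
  obtain ⟨p, hp⟩ := CharP.exists L
  obtain ⟨n, hpp, hn⟩ := FiniteField.card L p
  have hdvd : q ∣ p ^ (n : ℕ) := by rw [← hn, hL]; exact dvd_pow_self _ two_ne_zero
  obtain ⟨e, -, rfl⟩ := (Nat.dvd_prime_pow hpp).1 hdvd
  have := Fact.mk hpp
  have := charP_of_injective_algebraMap (algebraMap L k).injective p
  exact add_pow_char_pow a b p e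

theorem pow_pow_of_card (hL : Fintype.card L = q ^ 2) (a : L) : (a ^ q) ^ q = a := by
  rw [← pow_mul, ← sq, ← hL, FiniteField.pow_card]

end FiniteField

section AffineRegular

variable {q : ℕ} {k : Type*} [Field k]

theorem exists_le_ker_coordLift [IsAlgClosed k] (M : Ideal (CoordRing q k)) [M.IsMaximal] :
    ∃ (a b : k) (h : b ^ q + b = a ^ (q + 1)), M ≤ RingHom.ker (coordLift (k := k) a b h) := by
  let _ : Field (CoordRing q k ⧸ M) := Ideal.Quotient.field M
  have : Module.Finite k (CoordRing q k ⧸ M) :=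
    finite_of_finite_type_of_isJacobsonRing k (CoordRing q k ⧸ M)
  let e : k ≃ₐ[k] (CoordRing q k ⧸ M) := AlgEquiv.ofBijective (Algebra.ofId k _)
    IsAlgClosed.algebraMap_bijective_of_isIntegral
  let ψ : CoordRing q k →ₐ[k] k := e.symm.toAlgHom.comp (Ideal.Quotient.mkₐ k M)
  have hψ : (ψ coordY) ^ q + ψ coordY = (ψ coordX) ^ (q + 1) := by
    rw [← map_pow, ← map_pow, ← map_add, coordY_pow_add_coordY]
  refine ⟨ψ coordX, ψ coordY, hψ, fun g hg => ?_⟩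
  have hg0 : ψ g = 0 := by
    change e.symm (Ideal.Quotient.mk M g) = 0
    rw [Ideal.Quotient.eq_zero_iff_mem.2 hg, map_zero]
  have hcomp : coordLift _ _ hψ = ψ := AdjoinRoot.algHom_ext' (by ext; simp [coordLift, coordY])
    (coordLift_coordX _ _ hψ)
  rwa [RingHom.mem_ker, hcomp]

variable [hq : Fact (1 < q)]

theorem exists_algebraMap_eq_of_isRegularAt [IsAlgClosed k] {f : FunctionField q k}
    (hf : ∀ a b h, IsRegularAt f (affinePoint a b h)) :
    ∃ g : CoordRing q k, algebraMap _ _ g = f := by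
  let denominators : Ideal (CoordRing q k) :=
    (1 : Submodule (CoordRing q k) (FunctionField q k)).comap
      (LinearMap.toSpanSingleton (CoordRing q k) (FunctionField q k) f)
  suffices htop : denominators = ⊤ by
    have h1 : (1 : CoordRing q k) ∈ denominators := htop ▸ Submodule.mem_top
    simpa [denominators, Submodule.mem_one] using h1
  by_contra htop
  obtain ⟨M, hM, hle⟩ := Ideal.exists_le_maximal denominators htop
  obtain ⟨a, b, h, hker⟩ := exists_le_ker_coordLift M
  obtain ⟨c, n, A, B, -, hB, hB0, hBP, rfl, -⟩ := hf a b h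
  rw [eval_rep_eq_mul_eval_chartVal hB (affinePoint_rep_two_ne_zero a b h), chartVal_affinePoint,
    ← coordLift_aeval a b h] at hBP
  refine right_ne_zero_of_mul hBP (hker (hle (Submodule.mem_comap.2 (Submodule.mem_one.2
    ⟨MvPolynomial.aeval ![coordX, coordY, 1] A, ?_⟩))))
  rw [LinearMap.toSpanSingleton_apply, Algebra.smul_def, ← dehom_eq_algebraMap,
    ← dehom_eq_algebraMap, mul_div_cancel₀ _ hB0]

variable (q k) in
theorem linearIndepOn_coordMonomial :
    LinearIndepOn k (coordMonomial (q := q) (k := k)) {s | s.1 ≤ q} := by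
  obtain ⟨v, hv, hx, hy⟩ := exists_addValuation_origin q k
  have hind := linearIndepOn_of_injOn_valuation hv
    (e := fun s : ℕ × ℕ => (xFun : FunctionField q k) ^ s.1 * yFun ^ s.2)
    (fun s => map_pow_mul_pow hx hy s.1 s.2) (injOn_weight_origin q)
  refine LinearIndepOn.of_comp
    (IsScalarTower.toAlgHom k (CoordRing q k) (FunctionField q k)).toLinearMap ?_
  convert hind using 1
  exact funext algebraMap_coordMonomial

end AffineRegular

section Rationality

variable {q : ℕ} {L k : Type*} [Field L] [Field k] [Algebra L k]

/-- The action of an endomorphism `σ` of `k` over `L` on the coefficients of the elements of the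
coordinate ring. -/
def coeffMap (q : ℕ) (σ : k →ₐ[L] k) : CoordRing q k →ₐ[L] CoordRing q k :=
  AdjoinRoot.mapAlgHom (Polynomial.mapAlgHom σ) _ _ (dvd_of_eq (by simp [affinePoly]))

variable (σ : k →ₐ[L] k)

@[simp]
theorem coeffMap_coordX : coeffMap q σ coordX = coordX := by
  simp [coeffMap, coordX]

@[simp]
theorem coeffMap_coordY : coeffMap q σ coordY = coordY := by
  simp [coeffMap, coordY]

theorem coeffMap_smul (c : k) (g : CoordRing q k) :
    coeffMap q σ (c • g) = σ c • coeffMap q σ g := by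
  have hc : coeffMap q σ (algebraMap k _ c) = algebraMap k _ (σ c) := by
    simp [coeffMap, AdjoinRoot.algebraMap_eq']
  rw [Algebra.smul_def, Algebra.smul_def, map_mul, hc]

theorem coeffMap_linearCombination (l : ℕ × ℕ →₀ k) :
    coeffMap q σ (Finsupp.linearCombination k coordMonomial l) =
      Finsupp.linearCombination k coordMonomial (l.mapRange σ (map_zero σ)) := by
  rw [Finsupp.linearCombination_apply, Finsupp.linearCombination_apply, Finsupp.sum_mapRange_index
    (h := fun s c => c • coordMonomial s) fun _ => zero_smul k _, Finsupp.sum, Finsupp.sum, map_sum]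
  refine Finset.sum_congr rfl fun s _ => ?_
  rw [coeffMap_smul, coordMonomial, map_mul, map_pow, map_pow, coeffMap_coordX, coeffMap_coordY]

theorem coeffMap_aeval (A : MvPolynomial (Fin 2) L) :
    coeffMap q σ (MvPolynomial.aeval ![coordX, coordY] A) =
      MvPolynomial.aeval ![coordX, coordY] A := by
  have hcomp : (coeffMap q σ).comp (MvPolynomial.aeval ![coordX, coordY]) =
      MvPolynomial.aeval ![coordX, coordY] := by
    ext i
    fin_cases i <;> simp
  exact DFunLike.congr_fun hcomp A

theorem algebraMap_aeval_coord (A : MvPolynomial (Fin 2) L) :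
    algebraMap (CoordRing q k) (FunctionField q k) (MvPolynomial.aeval ![coordX, coordY] A) =
      MvPolynomial.aeval ![xFun, yFun] A := by
  rw [← MvPolynomial.aeval_algebraMap_apply]
  congr 2
  ext i
  fin_cases i <;> simp [xFun, yFun, coordX, coordY]

variable [hq : Fact (1 < q)]

theorem IsDefinedOver.coeffMap_eq {g : CoordRing q k}
    (hg : IsDefinedOver L (algebraMap _ (FunctionField q k) g)) : coeffMap q σ g = g := by
  obtain ⟨A, B, hB, hAB⟩ := hg
  rw [← algebraMap_aeval_coord, ← algebraMap_aeval_coord, eq_div_iff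
    (by rwa [algebraMap_aeval_coord]), ← map_mul] at hAB
  have hgB := IsFractionRing.injective (CoordRing q k) (FunctionField q k) hAB
  have hσ := congrArg (coeffMap q σ) hgB
  rw [map_mul, coeffMap_aeval, coeffMap_aeval, ← hgB] at hσ
  refine mul_right_cancel₀ (fun h0 => hB ?_) hσ
  rw [← algebraMap_aeval_coord, h0, map_zero]

theorem IsDefinedOver.coeff_eq {l : ℕ × ℕ →₀ k}
    (hl : l ∈ Finsupp.supported k k {s : ℕ × ℕ | s.1 ≤ q})
    (h : IsDefinedOver L (algebraMap (CoordRing q k) (FunctionField q k)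
      (Finsupp.linearCombination k coordMonomial l))) (s : ℕ × ℕ) : σ (l s) = l s := by
  have hσ := h.coeffMap_eq σ
  rw [coeffMap_linearCombination] at hσ
  have hmap : l.mapRange σ (map_zero σ) ∈ Finsupp.supported k k {s : ℕ × ℕ | s.1 ≤ q} :=
    (Finsupp.mem_supported _ _).2 fun s hs => hl (Finsupp.support_mapRange hs)
  have heq := linearIndepOn_iffₛ.1 (linearIndepOn_coordMonomial q k) _ hmap _ hl hσ
  simpa using DFunLike.congr_fun heq s

theorem IsDefinedOver.exists_algebraMap_eq_coeff [Finite L] {l : ℕ × ℕ →₀ k}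
    (hl : l ∈ Finsupp.supported k k {s : ℕ × ℕ | s.1 ≤ q})
    (h : IsDefinedOver L (algebraMap (CoordRing q k) (FunctionField q k)
      (Finsupp.linearCombination k coordMonomial l))) (s : ℕ × ℕ) :
    ∃ c : L, algebraMap L k c = l s := by
  have := Fintype.ofFinite L
  exact exists_algebraMap_eq_of_pow_card (h.coeff_eq (FiniteField.frobeniusAlgHom L k) hl s)

end Rationality

section Trace

variable {q : ℕ} {L : Type*} [Field L] [Fintype L]

/-- The trace `y ↦ y ^ q + y` to the subfield of order `q`, as an additive map. -/
def traceHom (hL : Fintype.card L = q ^ 2) : L →+ L where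
  toFun y := y ^ q + y
  map_zero' := by
    have : q ≠ 0 := by rintro rfl; simp at hL
    simp [this]
  map_add' a b := by rw [add_pow_of_card hL]; ring

theorem ncard_pow_add_mul_eq_zero_le {K : Type*} [Field K] (hq : 1 < q) (c : K) :
    {z : K | z ^ q + c * z = 0}.ncard ≤ q := by
  classical
  have hd : (Polynomial.C c * Polynomial.X).degree < (q : WithBot ℕ) :=
    (Polynomial.degree_C_mul_X_le c).trans_lt (by exact_mod_cast hq)
  have hm := Polynomial.monic_X_pow_add hd
  have hroots : {z : K | z ^ q + c * z = 0} =
      (Polynomial.X ^ q + Polynomial.C c * Polynomial.X).roots.toFinset := by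
    ext z
    simp [hm.ne_zero]
  rw [hroots, Set.ncard_coe_finset]
  refine (Multiset.toFinset_card_le _).trans ((Polynomial.card_roots' _).trans_eq ?_)
  refine Polynomial.natDegree_eq_of_degree_eq_some ?_
  rw [Polynomial.degree_add_eq_left_of_degree_lt (by rwa [Polynomial.degree_X_pow]),
    Polynomial.degree_X_pow]

theorem ncard_pow_eq_self_le {K : Type*} [Field K] (hq : 1 < q) :
    {z : K | z ^ q = z}.ncard ≤ q := by
  simpa [← sub_eq_add_neg, sub_eq_zero] using ncard_pow_add_mul_eq_zero_le hq (-1 : K)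

theorem range_traceHom_subset (hL : Fintype.card L = q ^ 2) :
    ((traceHom hL).range : Set L) ⊆ {z | z ^ q = z} := by
  rintro _ ⟨y, rfl⟩
  change (y ^ q + y) ^ q = y ^ q + y
  rw [add_pow_of_card hL, pow_pow_of_card hL, add_comm]

theorem card_ker_and_range_traceHom (hL : Fintype.card L = q ^ 2) (hq : 1 < q) :
    Nat.card (traceHom hL).ker = q ∧ Nat.card (traceHom hL).range = q := by
  have hker : Nat.card (traceHom hL).ker ≤ q := by
    have h := ncard_pow_add_mul_eq_zero_le hq (1 : L)
    simp only [one_mul] at h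
    exact h
  have hrange : Nat.card (traceHom hL).range ≤ q :=
    (Set.ncard_le_ncard (range_traceHom_subset hL)).trans (ncard_pow_eq_self_le hq)
  have hmul : Nat.card (traceHom hL).range * Nat.card (traceHom hL).ker = q * q := by
    rw [← sq, ← hL, ← Nat.card_eq_fintype_card, ← AddSubgroup.index_ker, AddSubgroup.index_mul_card]
  constructor <;> nlinarith

theorem exists_pow_add_eq (hL : Fintype.card L = q ^ 2) (hq : 1 < q) {z : L} (hz : z ^ q = z) :
    ∃ y : L, y ^ q + y = z := by
  have heq := Set.eq_of_subset_of_ncard_le (range_traceHom_subset hL)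
    ((ncard_pow_eq_self_le hq).trans_eq (card_ker_and_range_traceHom hL hq).2.symm)
  have hz' : z ∈ ((traceHom hL).range : Set L) := heq ▸ hz
  exact hz'

end Trace

/-! ## The Riemann-Roch space of the chord divisor -/

section ChordDivisor

variable {q : ℕ} {L : Type*} [Field L] {k : Type*} [Field k] [Algebra L k]

theorem baseChange_chordPoint (b : {b : L // b ≠ 0 ∧ b ^ q + b = 0}) :
    baseChange k (chordPoint b) = affinePoint 0 (algebraMap L k b) (by
      rw [← map_pow, ← map_add, b.2.2, map_zero, zero_pow (Nat.succ_ne_zero q)]) := by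
  rw [chordPoint, baseChange_affinePoint]
  simp only [map_zero]

theorem baseChange_chordPoint_injective :
    Function.Injective fun b : {b : L // b ≠ 0 ∧ b ^ q + b = 0} => baseChange k (chordPoint b) := by
  intro b c h
  simp only [baseChange_chordPoint] at h
  exact Subtype.ext ((algebraMap L k).injective (affinePoint_inj.1 h).2)

variable [Fintype L]

theorem chordDivisor_of_forall_ne (m : ℕ) {P : curve q k}
    (h : ∀ b : {b : L // b ≠ 0 ∧ b ^ q + b = 0}, baseChange k (chordPoint b) ≠ P) :
    chordDivisor q L k m P = 0 := by
  rw [chordDivisor, Finsupp.smul_apply, Finsupp.finsetSum_apply,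
    Finset.sum_eq_zero fun b _ => Finsupp.single_eq_of_ne' (h b), smul_zero]

theorem chordDivisor_baseChange (m : ℕ) (b : {b : L // b ≠ 0 ∧ b ^ q + b = 0}) :
    chordDivisor q L k m (baseChange k (chordPoint b)) = m := by
  rw [chordDivisor, Finsupp.smul_apply, Finsupp.finsetSum_apply, Finset.sum_eq_single b
    (fun c _ hc => Finsupp.single_eq_of_ne' (baseChange_chordPoint_injective.ne hc)) (by simp),
    Finsupp.single_eq_same, nsmul_eq_mul, mul_one]

theorem chordDivisor_infinity (hq : 1 < q) (m : ℕ) :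
    chordDivisor q L k m (infinityCurvePoint hq) = 0 :=
  chordDivisor_of_forall_ne m fun b => by
    rw [baseChange_chordPoint]
    exact affinePoint_ne_infinityCurvePoint hq

theorem chordDivisor_of_ne (m : ℕ) {a b : k} {h : b ^ q + b = a ^ (q + 1)} (hab : a ≠ 0 ∨ b = 0) :
    chordDivisor q L k m (affinePoint a b h) = 0 :=
  chordDivisor_of_forall_ne m fun c hc => by
    rw [baseChange_chordPoint, affinePoint_inj] at hc
    rcases hab with ha | hb
    · exact ha hc.1.symm
    · exact c.2.1 ((algebraMap L k).injective (by rw [hc.2, hb, map_zero]))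

theorem exists_chordPoint (hL : Fintype.card L = q ^ 2) {b : k} (h : b ^ q + b = 0 ^ (q + 1))
    (hb : b ≠ 0) :
    ∃ c : {c : L // c ≠ 0 ∧ c ^ q + c = 0}, baseChange k (chordPoint c) = affinePoint 0 b h := by
  have hb0 : b ^ q + b = 0 := by rw [h, zero_pow (Nat.succ_ne_zero q)]
  obtain ⟨c, rfl⟩ : ∃ c : L, algebraMap L k c = b := by
    apply exists_algebraMap_eq_of_pow_card
    have hadd := add_pow_of_card hL (b ^ q) b
    have hq0 : q ≠ 0 := by rintro rfl; simp at hL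
    rw [hb0, zero_pow hq0, ← pow_mul, ← sq, ← hL] at hadd
    linear_combination -hadd - hb0
  exact ⟨⟨c, fun h0 => hb (by rw [h0, map_zero]), (algebraMap L k).injective (by simpa using hb0)⟩,
    baseChange_chordPoint _⟩

theorem chordDivisor_chord (hL : Fintype.card L = q ^ 2) (m : ℕ) {b : k}
    {h : b ^ q + b = 0 ^ (q + 1)} (hb : b ≠ 0) :
    chordDivisor q L k m (affinePoint 0 b h) = m := by
  obtain ⟨c, hc⟩ := exists_chordPoint hL h hb
  rw [← hc, chordDivisor_baseChange]

theorem card_ne_zero_and_pow_add_eq_zero (hL : Fintype.card L = q ^ 2) (hq : 1 < q) :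
    Nat.card {b : L // b ≠ 0 ∧ b ^ q + b = 0} = q - 1 := by
  have hset : {b : L | b ≠ 0 ∧ b ^ q + b = 0} = ((traceHom hL).ker : Set L) \ {0} := by
    ext b
    exact and_comm
  exact (congrArg Set.ncard hset).trans ((Set.ncard_sdiff_singleton_of_mem (zero_mem _)).trans
    (congrArg (· - 1) (card_ker_and_range_traceHom hL hq).1))

theorem deg_chordDivisor [hq : Fact (1 < q)] (hL : Fintype.card L = q ^ 2) (m : ℕ) :
    (chordDivisor q L k m).deg = m * (q - 1) := by
  classical
  let degHom : Divisor q k →+ ℤ := Finsupp.liftAddHom fun _ => AddMonoidHom.id ℤ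
  have hsingle (P : curve q k) : degHom (Finsupp.single P 1) = 1 :=
    Finsupp.liftAddHom_apply_single _ _ _
  change degHom (chordDivisor q L k m) = _
  rw [chordDivisor, map_nsmul, map_sum, Finset.sum_congr rfl fun b _ => hsingle _, Finset.sum_const,
    Finset.card_univ, ← Nat.card_eq_fintype_card, card_ne_zero_and_pow_add_eq_zero hL hq.out,
    nsmul_eq_mul, nsmul_eq_mul, mul_one, Nat.cast_sub hq.out.le, Nat.cast_one]

end ChordDivisor

section RiemannRoch

/-- The exponents `(i, j)` of the functions `x ^ i * y ^ j / x ^ m` that span the Riemann-Roch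
space of the chord divisor. -/
def exponents (m : ℕ) : Finset (ℕ × ℕ) :=
  insert (m, 0) {s ∈ Finset.range m ×ˢ Finset.range m | 1 ≤ s.2 ∧ s.1 + s.2 < m}

theorem mem_exponents {m : ℕ} {s : ℕ × ℕ} :
    s ∈ exponents m ↔ s = (m, 0) ∨ 1 ≤ s.2 ∧ s.1 + s.2 < m := by
  simp only [exponents, Finset.mem_insert, Finset.mem_filter, Finset.mem_product, Finset.mem_range]
  exact or_congr_right (and_iff_right_of_imp fun h => by omega)

theorem mem_exponents_of_le {q m : ℕ} (hq : 0 < q) {s : ℕ × ℕ} (hO : m ≤ s.1 + (q + 1) * s.2)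
    (hI : q * s.1 + (q + 1) * s.2 ≤ q * m) : s ∈ exponents m := by
  obtain ⟨i, j⟩ := s
  simp only at hO hI
  rw [mem_exponents]
  rcases Nat.eq_zero_or_pos j with rfl | hj
  · have : i ≤ m := Nat.le_of_mul_le_mul_left (by simpa using hI) hq
    exact Or.inl (by rw [le_antisymm this (by simpa using hO)])
  · refine Or.inr ⟨hj, Nat.lt_of_mul_lt_mul_left (a := q) ?_⟩
    change q * (i + j) < q * m
    linarith

variable {q : ℕ} {L : Type*} [Field L] {k : Type*} [Field k] [Algebra L k]

theorem algebraMap_linearCombination_coordMonomial (l : ℕ × ℕ →₀ k) :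
    algebraMap (CoordRing q k) (FunctionField q k) (Finsupp.linearCombination k coordMonomial l) =
      Finsupp.linearCombination k (fun s : ℕ × ℕ => xFun ^ s.1 * yFun ^ s.2) l := by
  rw [← funext algebraMap_coordMonomial]
  exact Finsupp.apply_linearCombination k
    (IsScalarTower.toAlgHom k (CoordRing q k) (FunctionField q k)).toLinearMap _ l

variable [hq : Fact (1 < q)]

/-- The function `x ^ i * y ^ j / x ^ m`. -/
def basisFun (m : ℕ) (s : ℕ × ℕ) : FunctionField q k := xFun ^ s.1 * yFun ^ s.2 / xFun ^ m

theorem exists_isUniformizerAt (hqk : (q : k) = 0) (P : curve q k) : ∃ t, IsUniformizerAt t P := by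
  rcases eq_infinityCurvePoint_or_eq_affinePoint hq.out P with rfl | ⟨a, b, h, rfl⟩
  · exact ⟨_, isUniformizerAt_xFun_div_yFun⟩
  · exact ⟨_, isUniformizerAt_xFun_sub hqk a b h⟩

theorem ordGE_zero_iff (hqk : (q : k) = 0) {f : FunctionField q k} {P : curve q k} :
    OrdGE P 0 f ↔ IsRegularAt f P := by
  constructor
  · rintro ⟨t, -, r, hr, rfl⟩
    rwa [zpow_zero, mul_one]
  · intro hf
    obtain ⟨t, ht⟩ := exists_isUniformizerAt hqk P
    exact ⟨t, ht, f, hf, by rw [zpow_zero, mul_one]⟩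

theorem isRegularAt_pow_mul_pow_div_pow {P : curve q k} {t r w : FunctionField q k} (ht0 : t ≠ 0)
    (ht : IsRegularAt t P) (hr : IsRegularAt r P) {n : ℕ} (hw : w = r * t ^ n) {m i j : ℕ}
    (h : m ≤ i + n * j) : IsRegularAt (t ^ i * w ^ j / t ^ m) P := by
  obtain ⟨e, he⟩ := Nat.exists_eq_add_of_le h
  have heq : t ^ i * w ^ j / t ^ m = r ^ j * t ^ e := by
    rw [div_eq_iff (pow_ne_zero m ht0), hw, mul_pow, ← pow_mul, mul_left_comm, ← pow_add, he,
      pow_add, mul_assoc, mul_comm (t ^ m)]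
  rw [heq]
  exact (hr.pow j).mul (ht.pow e)

theorem OrdGE.isRegularAt_mul_pow {P : curve q k} {m : ℕ} {f g : FunctionField q k}
    (hf : OrdGE P (-m) f) (hg : HasValueAt g P 0) (hg0 : g ≠ 0) : IsRegularAt (f * g ^ m) P := by
  obtain ⟨t, ht, r, hr, rfl⟩ := hf
  obtain ⟨s, hs, rfl⟩ := ht.2 g hg
  have heq : r * t ^ (-m : ℤ) * (s * t) ^ m = r * s ^ m := by
    rw [mul_pow, zpow_neg, zpow_natCast, mul_assoc, mul_left_comm _ (s ^ m),
      inv_mul_cancel₀ (pow_ne_zero m (right_ne_zero_of_mul hg0)), mul_one]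
  rw [heq]
  exact hr.mul (hs.pow m)

theorem isRegularAt_basisFun_origin {m : ℕ} (hmq : m ≤ q) {s : ℕ × ℕ} (hs : s ∈ exponents m)
    (h : (0 : k) ^ q + 0 = 0 ^ (q + 1)) : IsRegularAt (basisFun m s) (affinePoint 0 0 h) := by
  obtain ⟨r, hr, hy⟩ := exists_yFun_eq_mul_xFun_pow h
  refine isRegularAt_pow_mul_pow_div_pow xFun_ne_zero ⟨_, hasValueAt_xFun 0 0 h⟩ hr hy ?_
  rcases mem_exponents.1 hs with rfl | ⟨hj, -⟩
  · exact Nat.le_add_right _ _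
  · nlinarith

theorem pow_mul_pow_div_pow_eq {F : Type*} [Field F] {x y : F} (hx : x ≠ 0) (hy : y ≠ 0)
    (i j d : ℕ) :
    x ^ i * y ^ j / x ^ (i + j + d) = (x / y) ^ i * y⁻¹ ^ d / (x / y) ^ (i + j + d) := by
  rw [div_pow, div_pow, inv_pow, pow_add y (i + j), pow_add y i]
  field_simp

theorem isRegularAt_basisFun_infinity {m : ℕ} (hmq : m ≤ q) {s : ℕ × ℕ} (hs : s ∈ exponents m) :
    IsRegularAt (basisFun m s : FunctionField q k) (infinityCurvePoint hq.out) := by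
  obtain ⟨r, hr, hy⟩ := exists_inv_yFun_eq_mul_pow (q := q) (k := k)
  obtain ⟨i, j⟩ := s
  obtain ⟨d, rfl, hd⟩ : ∃ d, m = i + j + d ∧ (d = 0 → j = 0) := by
    rcases mem_exponents.1 hs with h | h
    · obtain ⟨rfl, rfl⟩ := Prod.mk.inj h
      exact ⟨0, rfl, fun _ => rfl⟩
    · exact ⟨m - (i + j), by grind, by grind⟩
  rw [basisFun, pow_mul_pow_div_pow_eq xFun_ne_zero yFun_ne_zero]
  refine isRegularAt_pow_mul_pow_div_pow (div_ne_zero xFun_ne_zero yFun_ne_zero)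
    ⟨_, hasValueAt_xFun_div_yFun⟩ hr hy ?_
  rcases Nat.eq_zero_or_pos d with rfl | hd0
  · simp [hd rfl]
  · nlinarith

theorem isDefinedOver_basisFun (m : ℕ) (s : ℕ × ℕ) :
    IsDefinedOver L (basisFun m s : FunctionField q k) :=
  ⟨.X 0 ^ s.1 * .X 1 ^ s.2, .X 0 ^ m, by simp [xFun_ne_zero], by simp [basisFun]⟩

theorem IsDefinedOver.mul_xFun_pow {f : FunctionField q k} (hf : IsDefinedOver L f) (m : ℕ) :
    IsDefinedOver L (f * xFun ^ m) := by
  obtain ⟨g, h, hh, rfl⟩ := hf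
  exact ⟨g * .X 0 ^ m, h, hh, by simp [div_mul_eq_mul_div]⟩

theorem coe_mul_le_map_mul_pow {F : Type*} [Field F] {v : AddValuation F (WithTop ℤ)} {f x : F}
    (hf : 0 ≤ v f) {a : ℤ} (hx : v x = a) (m : ℕ) : ((a * m : ℤ) : WithTop ℤ) ≤ v (f * x ^ m) := by
  rw [AddValuation.map_mul, AddValuation.map_pow, hx, ← WithTop.coe_nsmul, nsmul_eq_mul, mul_comm]
  exact le_add_of_nonneg_left hf

theorem IsTrivialOn.le_weight_of_nonneg {v : AddValuation (FunctionField q k) (WithTop ℤ)}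
    (hv : IsTrivialOn k v) {a b : ℤ} (hx : v xFun = a) (hy : v yFun = b) {l : ℕ × ℕ →₀ k}
    (hl : Set.InjOn (fun s : ℕ × ℕ => a * s.1 + b * s.2) l.support) {f : FunctionField q k} {m : ℕ}
    (hf : 0 ≤ v f)
    (hlf : algebraMap (CoordRing q k) _ (Finsupp.linearCombination k coordMonomial l) =
      f * xFun ^ m)
    {s : ℕ × ℕ} (hs : s ∈ l.support) : a * m ≤ a * s.1 + b * s.2 := by
  have hm := coe_mul_le_map_mul_pow hf hx m
  rw [← hlf, algebraMap_linearCombination_coordMonomial] at hm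
  exact WithTop.coe_le_coe.1 (le_of_le_map_linearCombination
    (n := fun s : ℕ × ℕ => a * s.1 + b * s.2) hv (fun s => map_pow_mul_pow hx hy s.1 s.2) hl hm
    s hs)

theorem mem_exponents_of_mem_support {f : FunctionField q k} (h0 : (0 : k) ^ q + 0 = 0 ^ (q + 1))
    (hO : IsRegularAt f (affinePoint 0 0 h0)) (hI : IsRegularAt f (infinityCurvePoint hq.out))
    {l : ℕ × ℕ →₀ k} (hl : l ∈ Finsupp.supported k k {s : ℕ × ℕ | s.1 ≤ q}) {m : ℕ}
    (hlf : algebraMap (CoordRing q k) _ (Finsupp.linearCombination k coordMonomial l) =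
      f * xFun ^ m) :
    ∀ s ∈ l.support, s ∈ exponents m := by
  intro s hs
  obtain ⟨v, hv, hx, hy⟩ := exists_addValuation_origin q k
  obtain ⟨v', hv', hx', hy'⟩ := exists_addValuation_infinity q k
  have hwO := hv.le_weight_of_nonneg hx hy ((injOn_weight_origin q).mono hl)
    (hO.map_nonneg hv (isCenteredAt_origin hx hy h0)) hlf hs
  have hwI := hv'.le_weight_of_nonneg hx' hy' ((injOn_weight_infinity q).mono hl)
    (hI.map_nonneg hv' (isCenteredAt_infinityCurvePoint hx' hy')) hlf hs
  refine mem_exponents_of_le (Nat.zero_lt_of_lt hq.out) ?_ ?_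
  · zify
    linarith
  · zify
    linarith

variable [Fintype L]

theorem ordGE_basisFun (hL : Fintype.card L = q ^ 2) {m : ℕ} (hmq : m ≤ q) {s : ℕ × ℕ}
    (hs : s ∈ exponents m) (P : curve q k) :
    OrdGE P (-(chordDivisor q L k m) P) (basisFun m s) := by
  have hqk := natCast_eq_zero_of_card hL k
  rcases eq_infinityCurvePoint_or_eq_affinePoint hq.out P with rfl | ⟨a, b, h, rfl⟩
  · rw [chordDivisor_infinity, neg_zero, ordGE_zero_iff hqk]
    exact isRegularAt_basisFun_infinity hmq hs
  have hxy := ((hasValueAt_xFun a b h).pow s.1).mul ((hasValueAt_yFun a b h).pow s.2)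
  rcases ne_or_eq a 0 with ha | rfl
  · rw [chordDivisor_of_ne m (Or.inl ha), neg_zero, ordGE_zero_iff hqk, basisFun, div_eq_mul_inv]
    exact ⟨_, hxy.mul (((hasValueAt_xFun a b h).pow m).inv (pow_ne_zero m ha))⟩
  rcases eq_or_ne b 0 with rfl | hb
  · rw [chordDivisor_of_ne m (Or.inr rfl), neg_zero, ordGE_zero_iff hqk]
    exact isRegularAt_basisFun_origin hmq hs h
  · have ht := isUniformizerAt_xFun_sub hqk 0 b h
    rw [map_zero, sub_zero] at ht
    rw [chordDivisor_chord hL m hb]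
    exact ⟨xFun, ht, _, ⟨_, hxy⟩, by rw [zpow_neg, zpow_natCast, basisFun, div_eq_mul_inv]⟩

theorem isRegularAt_mul_xFun_pow (hL : Fintype.card L = q ^ 2) {m : ℕ} {f : FunctionField q k}
    (hf : ∀ P, OrdGE P (-(chordDivisor q L k m) P) f) (a b : k) (h : b ^ q + b = a ^ (q + 1)) :
    IsRegularAt (f * xFun ^ m) (affinePoint a b h) := by
  have hfP := hf (affinePoint a b h)
  by_cases hab : a ≠ 0 ∨ b = 0
  · rw [chordDivisor_of_ne m hab, neg_zero, ordGE_zero_iff (natCast_eq_zero_of_card hL k)] at hfP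
    exact hfP.mul ⟨_, (hasValueAt_xFun a b h).pow m⟩
  · push Not at hab
    obtain ⟨rfl, hb⟩ := hab
    rw [chordDivisor_chord hL m hb] at hfP
    exact hfP.isRegularAt_mul_pow (hasValueAt_xFun 0 b h) xFun_ne_zero

theorem riemannRoch_chordDivisor_le [IsAlgClosed k] (hL : Fintype.card L = q ^ 2) (m : ℕ) :
    riemannRoch L (chordDivisor q L k m) ≤
      Submodule.span L (basisFun m '' (exponents m : Set (ℕ × ℕ))) := by
  rintro f ⟨hdef, rfl | hf⟩
  · exact zero_mem _
  have hqk := natCast_eq_zero_of_card hL k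
  have h0 : (0 : k) ^ q + 0 = 0 ^ (q + 1) := by simp [Nat.ne_zero_of_lt hq.out]
  obtain ⟨g, hg⟩ := exists_algebraMap_eq_of_isRegularAt (isRegularAt_mul_xFun_pow hL hf)
  obtain ⟨l, hl, rfl⟩ := (Finsupp.mem_span_image_iff_linearCombination k).1
    (mem_span_coordMonomial g)
  have hO := hf (affinePoint 0 0 h0)
  have hI := hf (infinityCurvePoint hq.out)
  rw [chordDivisor_of_ne m (Or.inr rfl), neg_zero, ordGE_zero_iff hqk] at hO
  rw [chordDivisor_infinity, neg_zero, ordGE_zero_iff hqk] at hI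
  choose c hc using IsDefinedOver.exists_algebraMap_eq_coeff (L := L) hl
    (hg ▸ hdef.mul_xFun_pow m)
  have hsum : f = ∑ s ∈ l.support, c s • basisFun m s := by
    rw [← mul_div_cancel_right₀ f (pow_ne_zero m xFun_ne_zero), ← hg,
      Finsupp.linearCombination_apply, Finsupp.sum, map_sum, Finset.sum_div]
    refine Finset.sum_congr rfl fun s _ => ?_
    rw [← hc s, IsScalarTower.algebraMap_smul, Algebra.smul_def, map_mul, mul_div_assoc,
      algebraMap_coordMonomial, Algebra.smul_def, basisFun]
    rfl
  rw [hsum]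
  exact Submodule.sum_mem _ fun s hs => Submodule.smul_mem _ _ (Submodule.subset_span
    ⟨s, mem_exponents_of_mem_support h0 hO hI hl hg s hs, rfl⟩)

theorem riemannRoch_chordDivisor [IsAlgClosed k] (hL : Fintype.card L = q ^ 2) {m : ℕ}
    (hmq : m ≤ q) :
    riemannRoch L (chordDivisor q L k m) =
      Submodule.span L (basisFun m '' (exponents m : Set (ℕ × ℕ))) := by
  refine le_antisymm (riemannRoch_chordDivisor_le hL m) (Submodule.span_le.2 ?_)
  rintro _ ⟨s, hs, rfl⟩
  exact ⟨isDefinedOver_basisFun m s, Or.inr fun P => ordGE_basisFun hL hmq hs P⟩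

end RiemannRoch

/-! ## The stabilizer of `O` and `Y_∞` -/

section DiagonalGroup

variable {q : ℕ} {L : Type*} [Field L]

theorem isHomogeneous_form : (form q L).IsHomogeneous (q + 1) := by
  have hX := MvPolynomial.isHomogeneous_X (σ := Fin 3) L
  have h₁ := ((hX 1).pow q).mul (hX 2)
  have h₂ := (hX 1).mul ((hX 2).pow q)
  have h₃ := (hX 0).pow (q + 1)
  rw [one_mul] at h₁ h₂ h₃
  rw [add_comm] at h₂
  exact (h₁.add h₂).sub h₃

theorem mk_mem_curve_iff {w : Fin 3 → L} (hw : w ≠ 0) :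
    Projectivization.mk L w hw ∈ curve q L ↔
      w 1 ^ q * w 2 + w 1 * w 2 ^ q = w 0 ^ (q + 1) := by
  have hform : MvPolynomial.eval w (form q L) = 0 ↔
      w 1 ^ q * w 2 + w 1 * w 2 ^ q = w 0 ^ (q + 1) := by
    simp [form, sub_eq_zero]
  obtain ⟨c, hc⟩ := Projectivization.exists_smul_eq_mk_rep L w hw
  rw [← hform, curve, Set.mem_ofPred_eq, ← hc, Units.smul_def,
    eval_smul_of_isHomogeneous isHomogeneous_form, mul_eq_zero,
    or_iff_right (pow_ne_zero _ c.ne_zero)]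

variable (q L) in
/-- The homomorphism `a ↦ diag(a, a ^ (q + 1), 1)` to `GL(3, L)`. -/
def diagGL : Lˣ →* GL (Fin 3) L :=
  Units.map
    { toFun a := Matrix.diagonal ![a, a ^ (q + 1), 1]
      map_one' := by
        rw [one_pow, ← Matrix.diagonal_one]
        congr 1
        ext i
        fin_cases i <;> rfl
      map_mul' a b := by
        rw [Matrix.diagonal_mul_diagonal']
        congr 1
        ext i
        fin_cases i <;> simp [mul_pow] }

variable (q L) in
/-- The homomorphism `a ↦ diag(a, a ^ (q + 1), 1)` to `PGL(3, L)`, whose range is the stabilizer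
of `O` and `Y_∞` in `PGU(3, q)` if `L` has order `q ^ 2`. -/
def diagPGL : Lˣ →* PGL(3, L) := Matrix.ProjGenLinGroup.mk.comp (diagGL q L)

theorem diagGL_smul (a : Lˣ) (w : Fin 3 → L) :
    diagGL q L a • w = ![a * w 0, a ^ (q + 1) * w 1, w 2] := by
  change (Matrix.diagonal ![(a : L), (a : L) ^ (q + 1), 1]).mulVec w = _
  ext i
  rw [Matrix.mulVec_diagonal]
  fin_cases i <;> simp

theorem diagPGL_smul_mk (a : Lˣ) {w : Fin 3 → L} (hw : w ≠ 0) :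
    diagPGL q L a • Projectivization.mk L w hw =
      Projectivization.mk L ![a * w 0, a ^ (q + 1) * w 1, w 2]
        (diagGL_smul a w ▸ (smul_ne_zero_iff_ne (diagGL q L a)).2 hw) := by
  simp only [diagPGL, MonoidHom.comp_apply, Projectivization.PGL.mk_smul_mk, diagGL_smul]

theorem diagPGL_injective : Function.Injective (diagPGL q L) := by
  intro a b h
  have hsmul := congrArg (· • Projectivization.mk L (![1, 0, 1] : Fin 3 → L) (affine_ne_zero 1 0)) h
  simp only [diagPGL_smul_mk, Projectivization.mk_eq_mk_iff'] at hsmul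
  obtain ⟨c, hc⟩ := hsmul
  obtain rfl : c = 1 := by simpa using congrFun hc 2
  exact Units.ext (by simpa using (congrFun hc 0).symm)

theorem GL_smul_apply (g : GL (Fin 3) L) (w : Fin 3 → L) (i : Fin 3) :
    (g • w) i = g.1 i 0 * w 0 + g.1 i 1 * w 1 + g.1 i 2 * w 2 := by
  change (g.1.mulVec w) i = _
  rw [Matrix.mulVec, dotProduct, Fin.sum_univ_three]

theorem apply_eq_zero_of_smul_originPt {g : GL (Fin 3) L}
    (h : Matrix.ProjGenLinGroup.mk g • originPt L = originPt L) : g.1 0 2 = 0 ∧ g.1 1 2 = 0 := by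
  rw [originPt, Projectivization.PGL.mk_smul_mk, Projectivization.mk_eq_mk_iff'] at h
  obtain ⟨c, hc⟩ := h
  exact ⟨by simpa [GL_smul_apply] using (congrFun hc 0).symm,
    by simpa [GL_smul_apply] using (congrFun hc 1).symm⟩

theorem apply_eq_zero_of_smul_infinityPt {g : GL (Fin 3) L}
    (h : Matrix.ProjGenLinGroup.mk g • infinityPt L = infinityPt L) :
    g.1 0 1 = 0 ∧ g.1 2 1 = 0 := by
  rw [infinityPt, Projectivization.PGL.mk_smul_mk, Projectivization.mk_eq_mk_iff'] at h
  obtain ⟨c, hc⟩ := h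
  exact ⟨by simpa [GL_smul_apply] using (congrFun hc 0).symm,
    by simpa [GL_smul_apply] using (congrFun hc 2).symm⟩

/-- The linear map with rows `(a, 0, 0)`, `(b, c, 0)`, `(e, 0, f)` maps the affine rational points
of the Hermitian curve to points of the curve. -/
def PreservesEquation (q : ℕ) (a b c e f : L) : Prop :=
  ∀ x y : L, y ^ q + y = x ^ (q + 1) →
    (b * x + c * y) ^ q * (e * x + f) + (b * x + c * y) * (e * x + f) ^ q = (a * x) ^ (q + 1)

theorem preservesEquation_of_smul_curve {g : GL (Fin 3) L}
    (h : Matrix.ProjGenLinGroup.mk g • curve q L = curve q L) (h01 : g.1 0 1 = 0)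
    (h02 : g.1 0 2 = 0) (h12 : g.1 1 2 = 0) (h21 : g.1 2 1 = 0) :
    PreservesEquation q (g.1 0 0) (g.1 1 0) (g.1 1 1) (g.1 2 0) (g.1 2 2) := by
  intro x y hxy
  have hmem : Matrix.ProjGenLinGroup.mk g • (affinePoint x y hxy).1 ∈ curve q L :=
    h.subset (Set.smul_mem_smul_set (affinePoint x y hxy).2)
  rw [affinePoint, Projectivization.PGL.mk_smul_mk, mk_mem_curve_iff] at hmem
  simpa [GL_smul_apply, h01, h02, h12, h21] using hmem

end DiagonalGroup

section Stabilizer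

variable {q : ℕ} {L : Type*} [Field L] [Fintype L]

theorem pow_succ_pow_of_card (hL : Fintype.card L = q ^ 2) (a : L) :
    (a ^ (q + 1)) ^ q = a ^ (q + 1) := by
  rw [pow_succ, mul_pow, pow_pow_of_card hL, mul_comm]

theorem exists_ne_zero_pow_add_eq_zero (hL : Fintype.card L = q ^ 2) (hq : 1 < q) :
    ∃ b : L, b ≠ 0 ∧ b ^ q + b = 0 := by
  have hcard := card_ne_zero_and_pow_add_eq_zero hL hq
  obtain ⟨b⟩ := (Nat.card_pos_iff.1 (hcard ▸ Nat.sub_pos_of_lt hq)).1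
  exact ⟨b, b.2⟩

theorem exists_pow_add_eq_pow_succ_of_line (hL : Fintype.card L = q ^ 2) (hq : 1 < q) {μ : L}
    (hμ : μ ≠ 0) : ∃ x : L, x ≠ 0 ∧ (μ * x) ^ q + μ * x = x ^ (q + 1) := by
  obtain ⟨z, hz⟩ := exists_pow_add_eq hL hq (one_pow q : (1 : L) ^ q = 1)
  have hz0 : z ≠ 0 := by
    rintro rfl
    simp [Nat.ne_zero_of_lt hq] at hz
  set w := (z / μ) ^ q with hw
  have hw0 : w ≠ 0 := pow_ne_zero _ (div_ne_zero hz0 hμ)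
  have hwq : w ^ q = z / μ := pow_pow_of_card hL _
  have hone : μ ^ q * w + μ * w ^ q = 1 := by
    rw [hwq, hw, div_pow, mul_div_cancel₀ _ (pow_ne_zero _ hμ), mul_div_cancel₀ _ hμ, hz]
  refine ⟨w⁻¹, inv_ne_zero hw0, ?_⟩
  calc (μ * w⁻¹) ^ q + μ * w⁻¹ = w⁻¹ ^ (q + 1) * (μ ^ q * w + μ * w ^ q) := by
        rw [mul_pow, pow_succ, inv_pow]
        field_simp
    _ = w⁻¹ ^ (q + 1) := by rw [hone, mul_one]

section PreservesEquation

variable {a b c e f : L}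

theorem PreservesEquation.e_eq_zero (hL : Fintype.card L = q ^ 2) (hq : 1 < q)
    (h : PreservesEquation q a b c e f) (ha : a ≠ 0) (hf : f ≠ 0) : e = 0 := by
  by_contra he
  obtain ⟨y, hy⟩ := exists_pow_add_eq hL hq (pow_succ_pow_of_card hL (-f / e))
  have hxy := h _ y hy
  rw [mul_div_cancel₀ _ he, neg_add_cancel, zero_pow (Nat.ne_zero_of_lt hq), mul_zero, mul_zero,
    add_zero] at hxy
  exact pow_ne_zero _ (mul_ne_zero ha (div_ne_zero (neg_ne_zero.2 hf) he)) hxy.symm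

theorem PreservesEquation.b_eq_zero (hL : Fintype.card L = q ^ 2) (hq : 1 < q)
    (h : PreservesEquation q a b c e f) (ha : a ≠ 0) (hc : c ≠ 0) : b = 0 := by
  by_contra hb
  obtain ⟨x, hx0, hx⟩ := exists_pow_add_eq_pow_succ_of_line hL hq
    (div_ne_zero (neg_ne_zero.2 hb) hc)
  have hxy := h x _ hx
  have hzero : b * x + c * (-b / c * x) = 0 := by
    field_simp
    ring
  rw [hzero, zero_pow (Nat.ne_zero_of_lt hq), zero_mul, zero_mul, add_zero] at hxy
  exact pow_ne_zero _ (mul_ne_zero ha hx0) hxy.symm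

theorem PreservesEquation.pow_mul_eq (hL : Fintype.card L = q ^ 2) (hq : 1 < q)
    (h : PreservesEquation q a 0 c 0 f) : c ^ q * f = c * f ^ q := by
  obtain ⟨b, hb0, hb⟩ := exists_ne_zero_pow_add_eq_zero hL hq
  have hb' := h 0 b (by rw [hb, zero_pow (Nat.succ_ne_zero q)])
  rw [mul_zero, mul_zero, zero_add, zero_add, zero_pow (Nat.succ_ne_zero q), mul_pow,
    eq_neg_of_add_eq_zero_left hb] at hb'
  exact mul_left_cancel₀ hb0 (by linear_combination -hb')

theorem PreservesEquation.mul_pow_eq (hL : Fintype.card L = q ^ 2) (hq : 1 < q)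
    (h : PreservesEquation q a 0 c 0 f) : c * f ^ q = a ^ (q + 1) := by
  obtain ⟨z, hz⟩ := exists_pow_add_eq hL hq (one_pow q : (1 : L) ^ q = 1)
  have hz' := h 1 z (by rw [hz, one_pow])
  rw [mul_one, mul_one, zero_add, zero_add, mul_pow] at hz'
  linear_combination hz' - c * f ^ q * hz - z ^ q * h.pow_mul_eq hL hq

end PreservesEquation

theorem twoPointStabilizer_le_range (hL : Fintype.card L = q ^ 2) (hq : 1 < q) :
    twoPointStabilizer q L ≤ (diagPGL q L).range := by
  rintro γ ⟨⟨hcurve, hO⟩, hY⟩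
  obtain ⟨g, rfl⟩ := Matrix.ProjGenLinGroup.mk_surjective γ
  obtain ⟨h02, h12⟩ := apply_eq_zero_of_smul_originPt (MulAction.mem_stabilizer_iff.1 hO)
  obtain ⟨h01, h21⟩ := apply_eq_zero_of_smul_infinityPt (MulAction.mem_stabilizer_iff.1 hY)
  have heq := preservesEquation_of_smul_curve (MulAction.mem_stabilizer_iff.1 hcurve) h01 h02 h12
    h21
  have hdet : g.1 0 0 * g.1 1 1 * g.1 2 2 ≠ 0 := by
    have h := (Matrix.isUnits_det_units g).ne_zero
    rw [Matrix.det_fin_three, h01, h02, h12, h21] at h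
    simpa using h
  have h00 := left_ne_zero_of_mul (left_ne_zero_of_mul hdet)
  have h11 := right_ne_zero_of_mul (left_ne_zero_of_mul hdet)
  have h22 := right_ne_zero_of_mul hdet
  have h20 := heq.e_eq_zero hL hq h00 h22
  have h10 := heq.b_eq_zero hL hq h00 h11
  rw [h10, h20] at heq
  have hdiv : (g.1 0 0 / g.1 2 2) ^ (q + 1) * g.1 2 2 = g.1 1 1 := by
    rw [div_pow, ← heq.mul_pow_eq hL hq, pow_succ]
    field_simp
  refine ⟨Units.mk0 (g.1 0 0 / g.1 2 2) (div_ne_zero h00 h22),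
    Matrix.ProjGenLinGroup.mk_eq_mk_iff.2 ⟨Units.mk0 (g.1 2 2) h22, ?_⟩⟩
  ext i j
  fin_cases i <;> fin_cases j <;>
    simp [diagGL, Matrix.GeneralLinearGroup.scalar, h01, h02, h10, h12, h20, h21, h22, hdiv]

theorem range_le_twoPointStabilizer (hL : Fintype.card L = q ^ 2) :
    (diagPGL q L).range ≤ twoPointStabilizer q L := by
  rintro _ ⟨a, rfl⟩
  refine ⟨⟨(MulAction.mem_stabilizer_set' (Set.toFinite _)).2 fun P hP => ?_, ?_⟩, ?_⟩
  · induction P using Projectivization.ind with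
    | h w hw =>
      rw [mk_mem_curve_iff] at hP
      rw [diagPGL_smul_mk, mk_mem_curve_iff]
      simp only [Matrix.cons_val]
      rw [mul_pow, pow_succ_pow_of_card hL, mul_pow, ← hP]
      ring
  · refine MulAction.mem_stabilizer_iff.2 ?_
    rw [originPt, diagPGL_smul_mk]
    congr 1
    simp
  · refine MulAction.mem_stabilizer_iff.2 ?_
    rw [infinityPt, diagPGL_smul_mk, Projectivization.mk_eq_mk_iff']
    exact ⟨(a : L) ^ (q + 1), by simp⟩

theorem twoPointStabilizer_eq_range (hL : Fintype.card L = q ^ 2) (hq : 1 < q) :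
    twoPointStabilizer q L = (diagPGL q L).range :=
  le_antisymm (twoPointStabilizer_le_range hL hq) (range_le_twoPointStabilizer hL)

theorem isCyclic_twoPointStabilizer (hL : Fintype.card L = q ^ 2) (hq : 1 < q) :
    IsCyclic (twoPointStabilizer q L) := by
  rw [twoPointStabilizer_eq_range hL hq]
  exact isCyclic_of_surjective _ (diagPGL q L).rangeRestrict_surjective

theorem card_twoPointStabilizer (hL : Fintype.card L = q ^ 2) (hq : 1 < q) :
    Nat.card (twoPointStabilizer q L) = q ^ 2 - 1 := by
  rw [twoPointStabilizer_eq_range hL hq,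
    ← Nat.card_congr (MonoidHom.ofInjective (diagPGL_injective (q := q) (L := L))).toEquiv,
    Nat.card_units, Nat.card_eq_fintype_card, hL]

theorem diagPGL_smul_affinePoint (hL : Fintype.card L = q ^ 2) (a : Lˣ) {u v : L}
    (huv : v ^ q + v = u ^ (q + 1)) : diagPGL q L a • (affinePoint u v huv).1 =
      (affinePoint (a * u) (a ^ (q + 1) * v) (orbit_eq hL a u v huv)).1 := by
  rw [affinePoint, diagPGL_smul_mk]
  simp [affinePoint]

theorem smul_range_chordPoint (hL : Fintype.card L = q ^ 2) (hq : 1 < q) {γ : PGL(3, L)}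
    (hγ : γ ∈ twoPointStabilizer q L) :
    γ • Set.range (fun b => (chordPoint (q := q) (L := L) b).1) =
      Set.range (fun b => (chordPoint (q := q) (L := L) b).1) := by
  obtain ⟨a, rfl⟩ := twoPointStabilizer_le_range hL hq hγ
  refine MulAction.mem_stabilizer_iff.1 ((MulAction.mem_stabilizer_set' (Set.toFinite _)).2 ?_)
  rintro _ ⟨b, rfl⟩
  refine ⟨⟨(a : L) ^ (q + 1) * b, mul_ne_zero (pow_ne_zero _ a.ne_zero) b.2.1, ?_⟩, ?_⟩
  · rw [mul_pow, pow_succ_pow_of_card hL, ← mul_add, b.2.2, mul_zero]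
  · simp only [chordPoint, diagPGL_smul_affinePoint hL, mul_zero]

end Stabilizer

section Orbit

variable {q : ℕ} {L : Type*} [Field L] [Fintype L] {ω : Lˣ}

theorem pow_succ_injective_of_orderOf {G : Type*} [CancelMonoid G] {g : G} {n : ℕ}
    (hg : orderOf g = n) : Function.Injective fun i : Fin n => g ^ (i.1 + 1) := by
  intro i j hij
  simp only [pow_succ] at hij
  exact Fin.ext (pow_injOn_Iio_orderOf (by simp [hg]) (by simp [hg]) (mul_right_cancel hij))

theorem orderOf_eq_of_forall_mem_zpowers (hL : Fintype.card L = q ^ 2)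
    (hω : ∀ a : Lˣ, a ∈ Subgroup.zpowers ω) : orderOf ω = q ^ 2 - 1 := by
  rw [orderOf_eq_card_of_forall_mem_zpowers hω, Nat.card_units, Nat.card_eq_fintype_card, hL]

theorem exists_pow_succ_eq (hL : Fintype.card L = q ^ 2)
    (hω : ∀ a : Lˣ, a ∈ Subgroup.zpowers ω) (a : Lˣ) :
    ∃ i : Fin (q ^ 2 - 1), ω ^ (i.1 + 1) = a := by
  classical
  obtain ⟨n, hlt, hn⟩ := Finset.mem_image.1
    ((isOfFinOrder_of_finite ω).mem_zpowers_iff_mem_range_orderOf.1 (hω (a * ω⁻¹)))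
  rw [Finset.mem_range, orderOf_eq_of_forall_mem_zpowers hL hω] at hlt
  exact ⟨⟨n, hlt⟩, by rw [pow_succ, hn, inv_mul_cancel_right]⟩

theorem diagPGL_pow_smul_affinePoint (hL : Fintype.card L = q ^ 2) {u v : L}
    (huv : v ^ q + v = u ^ (q + 1)) (i : Fin (q ^ 2 - 1)) :
    diagPGL q L (ω ^ (i.1 + 1)) • (affinePoint u v huv).1 = (orbitPoint hL ω u v huv i).1 := by
  rw [diagPGL_smul_affinePoint hL]
  simp only [orbitPoint, Units.val_pow_eq_pow_val]

theorem range_orbitPoint (hL : Fintype.card L = q ^ 2) (hq : 1 < q)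
    (hω : ∀ a : Lˣ, a ∈ Subgroup.zpowers ω) {u v : L} (huv : v ^ q + v = u ^ (q + 1)) :
    Set.range (fun i => (orbitPoint hL ω u v huv i).1) =
      MulAction.orbit (twoPointStabilizer q L) (affinePoint u v huv).1 := by
  refine Set.Subset.antisymm ?_ ?_
  · rintro _ ⟨i, rfl⟩
    exact ⟨⟨_, range_le_twoPointStabilizer hL ⟨_, rfl⟩⟩, diagPGL_pow_smul_affinePoint hL huv i⟩
  · rintro _ ⟨⟨γ, hγ⟩, rfl⟩
    obtain ⟨a, rfl⟩ := twoPointStabilizer_le_range hL hq hγ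
    obtain ⟨i, rfl⟩ := exists_pow_succ_eq hL hω a
    exact ⟨i, (diagPGL_pow_smul_affinePoint hL huv i).symm⟩

theorem orbitPoint_injective (hL : Fintype.card L = q ^ 2)
    (hω : ∀ a : Lˣ, a ∈ Subgroup.zpowers ω) {u v : L} (huv : v ^ q + v = u ^ (q + 1))
    (hu : u ≠ 0) : Function.Injective (orbitPoint hL ω u v huv) := by
  intro i j hij
  exact pow_succ_injective_of_orderOf (orderOf_eq_of_forall_mem_zpowers hL hω)
    (Units.ext (by simpa using mul_right_cancel₀ hu (affinePoint_inj.1 hij).1))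

end Orbit

/-! ## Evaluation of polynomials at the powers of an element -/

section MinDistance

variable {L : Type*} [Field L] [DecidableEq L] {n : ℕ}

theorem hammingNorm_add_card_zeros (c : Fin n → L) :
    hammingNorm c + (Finset.univ.filter fun i => c i = 0).card = n := by
  rw [hammingNorm, add_comm, Finset.card_filter_add_card_filter_not, Finset.card_univ,
    Fintype.card_fin]

theorem IsMinDistance.le_hammingNorm {C : Submodule L (Fin n → L)} {d : ℕ}
    (hd : IsMinDistance C d) {c : Fin n → L} (hc : c ∈ C) (hc0 : c ≠ 0) : d ≤ hammingNorm c :=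
  hd.2 ⟨c, hc, 0, zero_mem C, hc0, by rw [← hammingDist_zero_right]; congr!⟩

theorem exists_isMinDistance_hammingNorm {C : Submodule L (Fin n → L)} (hC : C ≠ ⊥) :
    ∃ c ∈ C, c ≠ 0 ∧ IsMinDistance C (hammingNorm c) := by
  obtain ⟨w, hw, hw0⟩ := C.exists_mem_ne_zero_of_ne_bot hC
  have hleast := Nat.sInf_mem (s := {d | ∃ c ∈ C, c ≠ 0 ∧ hammingNorm c = d}) ⟨_, w, hw, hw0, rfl⟩
  obtain ⟨c, hc, hc0, hcmin⟩ := hleast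
  refine ⟨c, hc, hc0, ⟨c, hc, 0, zero_mem C, hc0, ?_⟩, ?_⟩
  · rw [← hammingDist_zero_right]
    congr!
  · rintro _ ⟨a, ha, b, hb, hab, rfl⟩
    rw [hcmin]
    refine Nat.sInf_le ⟨a - b, sub_mem ha hb, sub_ne_zero.2 hab, ?_⟩
    rw [sub_eq_neg_add, ← hammingDist_eq_hammingNorm, hammingDist_comm]
    congr!

end MinDistance

section EvalPowers

variable {L : Type*} [Field L] {n : ℕ} {ω : L}

/-- The evaluation of a polynomial at the powers `ω, ω ^ 2, …, ω ^ n`, which turns spaces of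
polynomials into codes of length `n`. -/
def evalPowers (ω : L) (n : ℕ) : Polynomial L →ₗ[L] Fin n → L :=
  LinearMap.pi fun i => Polynomial.leval (ω ^ (i.1 + 1))

@[simp]
theorem evalPowers_apply (p : Polynomial L) (i : Fin n) :
    evalPowers ω n p i = p.eval (ω ^ (i.1 + 1)) :=
  rfl

theorem pow_finRotate {M : Type*} [Monoid M] {a : M} (ha : a ^ n = 1) (i : Fin n) :
    a ^ (finRotate n i).1 = a ^ (i.1 + 1) := by
  cases n with
  | zero => exact i.elim0
  | succ n =>
    rw [finRotate_apply, Fin.val_add_one]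
    split_ifs with h
    · rw [h, Fin.val_last, ha, pow_zero]
    · rfl

theorem isCyclicCode_map_evalPowers (hω : ω ^ n = 1) {V : Submodule L (Polynomial L)}
    (hV : ∀ p ∈ V, p.comp (Polynomial.C ω * Polynomial.X) ∈ V) :
    IsCyclicCode (V.map (evalPowers ω n)) := by
  rintro _ ⟨p, hp, rfl⟩
  refine ⟨_, hV p hp, funext fun i => ?_⟩
  simp only [evalPowers_apply, Polynomial.eval_comp, Polynomial.eval_mul, Polynomial.eval_C,
    Polynomial.eval_X, pow_succ, pow_finRotate hω, mul_comm]

theorem le_hammingNorm_evalPowers_add [DecidableEq L]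
    (hinj : Function.Injective fun i : Fin n => ω ^ (i.1 + 1)) {p : Polynomial L} (hp : p ≠ 0) :
    n ≤ hammingNorm (evalPowers ω n p) + p.natDegree := by
  have hroots : (Finset.univ.filter fun i => evalPowers ω n p i = 0).card ≤ p.natDegree := by
    rw [← Finset.card_image_of_injective _ hinj]
    refine Polynomial.card_le_degree_of_subset_roots fun z hz => ?_
    obtain ⟨i, hi, rfl⟩ := Finset.mem_image.1 (Finset.mem_def.2 hz)
    exact (Polynomial.mem_roots hp).2 (Finset.mem_filter.1 hi).2
  have := hammingNorm_add_card_zeros (evalPowers ω n p)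
  lia

theorem injOn_evalPowers_degreeLT (hinj : Function.Injective fun i : Fin n => ω ^ (i.1 + 1)) :
    Set.InjOn (evalPowers ω n) (Polynomial.degreeLT L n) := by
  classical
  refine LinearMap.injOn_of_disjoint_ker subset_rfl (Submodule.disjoint_def.2 fun p hp hker => ?_)
  by_contra hp0
  have := le_hammingNorm_evalPowers_add hinj hp0
  rw [LinearMap.mem_ker.1 hker, hammingNorm_zero, zero_add] at this
  exact this.not_gt ((Polynomial.natDegree_lt_iff_degree_lt hp0).2 (Polynomial.mem_degreeLT.1 hp))

/-- The polynomial `(X - ξ) (X - ξ ^ 2) ⋯ (X - ξ ^ M)`. Its expansion by `d`, with `ξ = ω ^ d`, has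
many zeros among the powers of `ω`, and gives a codeword of low weight. -/
def powRootsPoly (ξ : L) (M : ℕ) : Polynomial L :=
  ∏ l ∈ Finset.range M, (Polynomial.X - Polynomial.C (ξ ^ (l + 1)))

theorem monic_powRootsPoly (ξ : L) (M : ℕ) : (powRootsPoly ξ M).Monic :=
  Polynomial.monic_prod_of_monic _ _ fun _ _ => Polynomial.monic_X_sub_C _

theorem natDegree_powRootsPoly (ξ : L) (M : ℕ) : (powRootsPoly ξ M).natDegree = M := by
  rw [powRootsPoly, Polynomial.natDegree_finsetProd_X_sub_C_eq_card, Finset.card_range]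

theorem eval_powRootsPoly {ξ : L} {M l : ℕ} (hl : l < M) :
    (powRootsPoly ξ M).eval (ξ ^ (l + 1)) = 0 := by
  rw [powRootsPoly, Polynomial.eval_prod]
  exact Finset.prod_eq_zero (Finset.mem_range.2 hl) (by simp)

theorem eval_expand_powRootsPoly {d e M : ℕ} (hω : ω ^ (d * e) = 1) {l : ℕ} (hl : l < M) (t : ℕ) :
    (Polynomial.expand L d (powRootsPoly (ω ^ d) M)).eval (ω ^ (l + e * t + 1)) = 0 := by
  have hexp : (l + e * t + 1) * d = d * (l + 1) + d * e * t := by ring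
  have hpow : (ω ^ (l + e * t + 1)) ^ d = (ω ^ d) ^ (l + 1) := by
    rw [← pow_mul, hexp, pow_add, pow_mul ω (d * e), hω, one_pow, mul_one, pow_mul]
  rw [Polynomial.expand_eval, hpow, eval_powRootsPoly hl]

theorem hammingNorm_evalPowers_add_le [DecidableEq L] {d e M : ℕ} (hn : n = d * e) (hM : M ≤ e)
    (hω : ω ^ n = 1) {p : Polynomial L}
    (hp : Polynomial.expand L d (powRootsPoly (ω ^ d) M) ∣ p) :
    hammingNorm (evalPowers ω n p) + M * d ≤ n := by
  subst hn
  let zero (x : Fin d × Fin M) : Fin (d * e) := finProdFinEquiv (x.1, x.2.castLE hM)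
  have hzero : Function.Injective zero := finProdFinEquiv.injective.comp
    (Function.injective_id.prodMap (Fin.castLE_injective hM))
  have hcard : M * d ≤ (Finset.univ.filter fun i => evalPowers ω (d * e) p i = 0).card := by
    have : (Finset.univ.image zero).card = M * d := by
      rw [Finset.card_image_of_injective _ hzero, Finset.card_univ, Fintype.card_prod,
        Fintype.card_fin, Fintype.card_fin, mul_comm]
    rw [← this]
    refine Finset.card_le_card (Finset.image_subset_iff.2 fun x _ => ?_)
    exact Finset.mem_filter.2 ⟨Finset.mem_univ _, Polynomial.eval_eq_zero_of_dvd_of_eval_eq_zero hp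
      (eval_expand_powRootsPoly hω x.2.2 x.1)⟩
  have := hammingNorm_add_card_zeros (evalPowers ω (d * e) p)
  lia

end EvalPowers

/-! ## The code of the orbit -/

section OrbitPolynomials

variable {q m : ℕ} {s : ℕ × ℕ}

theorem fst_le_of_mem_exponents (hmq : m ≤ q) (hs : s ∈ exponents m) : s.1 ≤ q := by
  rcases mem_exponents.1 hs with rfl | h
  · exact hmq
  · lia

theorem le_weight_of_mem_exponents (hmq : m ≤ q) (hs : s ∈ exponents m) :
    m ≤ s.1 + (q + 1) * s.2 := by
  rcases mem_exponents.1 hs with rfl | ⟨hj, -⟩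
  · exact Nat.le_add_right _ _
  · calc
      m ≤ (q + 1) * 1 := by lia
      _ ≤ (q + 1) * s.2 := Nat.mul_le_mul_left _ hj
      _ ≤ s.1 + (q + 1) * s.2 := Nat.le_add_left _ _

theorem weight_sub_le_of_mem_exponents (hs : s ∈ exponents m) :
    s.1 + (q + 1) * s.2 - m ≤ q * (m - 1) - 1 := by
  rcases mem_exponents.1 hs with rfl | ⟨-, hij⟩
  · simp
  · have hj : q * s.2 ≤ q * (m - 1) := Nat.mul_le_mul_left _ (by lia)
    rw [Nat.add_one_mul]
    lia

theorem injOn_weight_exponents (hmq : m ≤ q) :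
    Set.InjOn (fun s : ℕ × ℕ => s.1 + (q + 1) * s.2 - m) (exponents m : Set (ℕ × ℕ)) := by
  intro s hs t ht hst
  refine injOn_weight_origin q (fst_le_of_mem_exponents hmq hs) (fst_le_of_mem_exponents hmq ht) ?_
  have hs' := le_weight_of_mem_exponents hmq hs
  have ht' := le_weight_of_mem_exponents hmq ht
  have h : s.1 + (q + 1) * s.2 = t.1 + (q + 1) * t.2 := by simp only at hst; lia
  simp only [one_mul]
  exact_mod_cast h

theorem card_exponents (m : ℕ) : (exponents m).card = m * (m - 1) / 2 + 1 := by
  have hsigma : ((Finset.range m).sigma Finset.range).card = ∑ l ∈ Finset.range m, l := by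
    simp only [Finset.card_sigma, Finset.card_range]
  rw [exponents, Finset.card_insert_of_notMem (by simp), ← Finset.sum_range_id, ← hsigma]
  congr 1
  refine Finset.card_bij' (fun s _ => ⟨s.1 + s.2, s.1⟩) (fun p _ => (p.2, p.1 - p.2)) ?_ ?_ ?_ ?_
  · rintro ⟨i, j⟩ hs
    simp only [Finset.mem_filter, Finset.mem_product, Finset.mem_range, Finset.mem_sigma] at hs ⊢
    lia
  · rintro ⟨l, i⟩ hs
    simp only [Finset.mem_filter, Finset.mem_product, Finset.mem_range, Finset.mem_sigma] at hs ⊢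
    lia
  · rintro ⟨i, j⟩ -
    rw [Nat.add_sub_cancel_left]
  · rintro ⟨l, i⟩ hs
    have hi : i < l := Finset.mem_range.1 (Finset.mem_sigma.1 hs).2
    rw [Nat.add_sub_cancel' hi.le]

variable {L : Type*} [Field L] {u v : L}

/-- The restriction of `x ^ i * y ^ j / x ^ m` to the orbit `T ↦ (T * u, T ^ (q + 1) * v)`, as a
monomial in `T`. The exponent does not truncate for `(i, j)` in `exponents m`. -/
def orbitMonomial (q m : ℕ) (u v : L) (s : ℕ × ℕ) : Polynomial L :=
  Polynomial.monomial (s.1 + (q + 1) * s.2 - m) (u ^ s.1 * v ^ s.2 / u ^ m)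

theorem eval_orbitMonomial (hmq : m ≤ q) (hs : s ∈ exponents m) {T : L} (hT : T ≠ 0) :
    (orbitMonomial q m u v s).eval T =
      (T * u) ^ s.1 * (T ^ (q + 1) * v) ^ s.2 / (T * u) ^ m := by
  rw [orbitMonomial, Polynomial.eval_monomial,
    pow_sub₀ _ hT (le_weight_of_mem_exponents hmq hs), mul_pow, mul_pow, mul_pow, pow_add, pow_mul]
  ring

theorem linearIndepOn_orbitMonomial (hmq : m ≤ q) (hu : u ≠ 0) (hv : v ≠ 0) :
    LinearIndepOn L (orbitMonomial q m u v) (exponents m : Set (ℕ × ℕ)) := by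
  have hmonomial := ((Polynomial.basisMonomials L).linearIndepOn _).comp_of_image
    (injOn_weight_exponents hmq)
  have hcoeff (s : ℕ × ℕ) : u ^ s.1 * v ^ s.2 / u ^ m ≠ 0 :=
    div_ne_zero (mul_ne_zero (pow_ne_zero _ hu) (pow_ne_zero _ hv)) (pow_ne_zero _ hu)
  rw [LinearIndepOn]
  convert hmonomial.linearIndependent.units_smul fun s => Units.mk0 _ (hcoeff s) using 1
  ext1 s
  simp [orbitMonomial, Units.smul_def, Polynomial.smul_monomial]

variable (q m u v) in
/-- The restrictions to the orbit `T ↦ (T * u, T ^ (q + 1) * v)` of the functions of the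
Riemann-Roch space of the chord divisor, as polynomials in `T`. -/
def orbitPolynomials : Submodule L (Polynomial L) :=
  Submodule.span L (orbitMonomial q m u v '' (exponents m : Set (ℕ × ℕ)))

theorem orbitMonomial_mem (hs : s ∈ exponents m) :
    orbitMonomial q m u v s ∈ orbitPolynomials q m u v :=
  Submodule.subset_span ⟨s, hs, rfl⟩

theorem natDegree_le_of_mem_orbitPolynomials {p : Polynomial L}
    (hp : p ∈ orbitPolynomials q m u v) : p.natDegree ≤ q * (m - 1) - 1 := by
  refine Polynomial.natDegree_le_iff_degree_le.2 (Polynomial.mem_degreeLE.1 (?_ : _ ∈ _))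
  refine (Submodule.span_le.2 ?_ : orbitPolynomials q m u v ≤ _) hp
  rintro _ ⟨s, hs, rfl⟩
  exact Polynomial.mem_degreeLE.2 ((Polynomial.degree_monomial_le _ _).trans
    (Nat.cast_le.2 (weight_sub_le_of_mem_exponents hs)))

theorem comp_mem_orbitPolynomials (ω : L) {p : Polynomial L} (hp : p ∈ orbitPolynomials q m u v) :
    p.comp (Polynomial.C ω * Polynomial.X) ∈ orbitPolynomials q m u v := by
  rw [Polynomial.comp_eq_aeval]
  refine (Submodule.span_le.2 ?_ : _ ≤ (orbitPolynomials q m u v).comap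
    (Polynomial.aeval (Polynomial.C ω * Polynomial.X)).toLinearMap) hp
  rintro _ ⟨s, hs, rfl⟩
  have hcomp : Polynomial.aeval (Polynomial.C ω * Polynomial.X) (orbitMonomial q m u v s) =
      ω ^ (s.1 + (q + 1) * s.2 - m) • orbitMonomial q m u v s := by
    rw [orbitMonomial, Polynomial.aeval_monomial, mul_pow, ← Polynomial.C_pow,
      Polynomial.algebraMap_eq, mul_left_comm, Polynomial.C_mul_X_pow_eq_monomial,
      ← Polynomial.smul_eq_C_mul]
  exact (hcomp ▸ Submodule.smul_mem _ _ (orbitMonomial_mem hs) : _ ∈ orbitPolynomials q m u v)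

theorem X_pow_mul_expand_mem_orbitPolynomials (hm : 2 ≤ m) (hmq : m ≤ q) (hu : u ≠ 0) (hv : v ≠ 0)
    {R : Polynomial L} (hR : R.natDegree ≤ m - 2) :
    Polynomial.X ^ (q + 1 - m) * Polynomial.expand L (q + 1) R ∈ orbitPolynomials q m u v := by
  rw [R.as_sum_range' (m - 1) (by lia), map_sum, Finset.mul_sum]
  refine Submodule.sum_mem _ fun j hj => ?_
  have hj' : j < m - 1 := Finset.mem_range.1 hj
  have hs : (0, j + 1) ∈ exponents m :=
    mem_exponents.2 (Or.inr ⟨Nat.le_add_left 1 j, by simp only; lia⟩)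
  have hexp : q + 1 - m + j * (q + 1) = 0 + (q + 1) * (j + 1) - m := by
    rw [mul_add_one, mul_comm j]
    lia
  have hmul : Polynomial.X ^ (q + 1 - m) * Polynomial.expand L (q + 1)
      (Polynomial.monomial j (R.coeff j)) =
      (R.coeff j * u ^ m / v ^ (j + 1)) • orbitMonomial q m u v (0, j + 1) := by
    rw [Polynomial.expand_monomial, Polynomial.X_pow_mul_monomial, orbitMonomial,
      Polynomial.smul_monomial, smul_eq_mul, ← hexp, add_comm]
    congr 1
    rw [pow_zero, one_mul, div_mul_div_cancel₀ (pow_ne_zero _ hv),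
      mul_div_cancel_right₀ _ (pow_ne_zero _ hu)]
  exact hmul ▸ Submodule.smul_mem _ _ (orbitMonomial_mem hs)

end OrbitPolynomials

section Evaluation

variable {q : ℕ} {L : Type*} [Field L] {k : Type*} [Field k] [Algebra L k] [hq : Fact (1 < q)]

section

variable {n : ℕ} {Q : Fin n → curve q L}

theorem HasEvaluation.unique {f : FunctionField q k} {c d : Fin n → L} (hc : HasEvaluation Q f c)
    (hd : HasEvaluation Q f d) : c = d :=
  funext fun i => (algebraMap L k).injective ((hc i).unique (hd i))

variable {ι : Type*} {b : ι → FunctionField q k} {c : ι → Fin n → L} {S : Set ι}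

theorem HasEvaluation.linearCombination (h : ∀ s ∈ S, HasEvaluation Q (b s) (c s)) {l : ι →₀ L}
    (hl : l ∈ Finsupp.supported L L S) :
    HasEvaluation Q (Finsupp.linearCombination L b l) (Finsupp.linearCombination L c l) := by
  intro i
  rw [Finsupp.linearCombination_apply, Finsupp.linearCombination_apply, Finsupp.sum, Finsupp.sum,
    Finset.sum_apply, map_sum]
  refine HasValueAt.sum _ fun s hs => ?_
  rw [← IsScalarTower.algebraMap_smul k (l s) (b s), Algebra.smul_def, Pi.smul_apply, smul_eq_mul,
    map_mul]
  exact (HasValueAt.const _ _).mul (h s (hl hs) i)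

variable {G : Divisor q k}

theorem existsUnique_hasEvaluation (hG : riemannRoch L G = Submodule.span L (b '' S))
    (h : ∀ s ∈ S, HasEvaluation Q (b s) (c s)) {f : FunctionField q k} (hf : f ∈ riemannRoch L G) :
    ∃! w, HasEvaluation Q f w := by
  rw [hG] at hf
  obtain ⟨l, hl, rfl⟩ := (Finsupp.mem_span_image_iff_linearCombination L).1 hf
  have hl' := HasEvaluation.linearCombination h hl
  exact ⟨_, hl', fun w hw => hw.unique hl'⟩

theorem eq_zero_of_hasEvaluation_zero (hG : riemannRoch L G = Submodule.span L (b '' S))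
    (h : ∀ s ∈ S, HasEvaluation Q (b s) (c s)) (hc : LinearIndepOn L c S) {f : FunctionField q k}
    (hf : f ∈ riemannRoch L G) (hf0 : HasEvaluation Q f 0) : f = 0 := by
  rw [hG] at hf
  obtain ⟨l, hl, rfl⟩ := (Finsupp.mem_span_image_iff_linearCombination L).1 hf
  rw [linearIndepOn_iff.1 hc l hl ((HasEvaluation.linearCombination h hl).unique hf0), map_zero]

theorem functionalCode_eq_span (hG : riemannRoch L G = Submodule.span L (b '' S))
    (h : ∀ s ∈ S, HasEvaluation Q (b s) (c s)) :
    functionalCode Q G = Submodule.span L (c '' S) := by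
  ext w
  rw [Finsupp.mem_span_image_iff_linearCombination]
  constructor
  · rintro ⟨f, hf, hfw⟩
    rw [hG] at hf
    obtain ⟨l, hl, rfl⟩ := (Finsupp.mem_span_image_iff_linearCombination L).1 hf
    exact ⟨l, hl, (HasEvaluation.linearCombination h hl).unique hfw⟩
  · rintro ⟨l, hl, rfl⟩
    refine ⟨_, ?_, HasEvaluation.linearCombination h hl⟩
    rw [hG]
    exact (Finsupp.mem_span_image_iff_linearCombination L).2 ⟨l, hl, rfl⟩

end

theorem hasValueAt_basisFun {a b : k} (h : b ^ q + b = a ^ (q + 1)) (ha : a ≠ 0) (m : ℕ)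
    (s : ℕ × ℕ) : HasValueAt (basisFun m s) (affinePoint a b h) (a ^ s.1 * b ^ s.2 / a ^ m) := by
  rw [basisFun, div_eq_mul_inv, div_eq_mul_inv]
  exact (((hasValueAt_xFun a b h).pow _).mul ((hasValueAt_yFun a b h).pow _)).mul
    (((hasValueAt_xFun a b h).pow m).inv (pow_ne_zero m ha))

variable [Fintype L] {m : ℕ} {ω : Lˣ} {u v : L}

theorem hasEvaluation_basisFun (hL : Fintype.card L = q ^ 2) (hmq : m ≤ q)
    (huv : v ^ q + v = u ^ (q + 1)) (hu : u ≠ 0) {s : ℕ × ℕ} (hs : s ∈ exponents m) :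
    HasEvaluation (orbitPoint hL ω u v huv) (basisFun m s : FunctionField q k)
      (evalPowers (ω : L) (q ^ 2 - 1) (orbitMonomial q m u v s)) := by
  intro i
  have hω : (ω : L) ^ (i.1 + 1) ≠ 0 := pow_ne_zero _ ω.ne_zero
  rw [evalPowers_apply, eval_orbitMonomial hmq hs hω, map_div₀, map_mul, map_pow, map_pow _ _ s.2,
    map_pow _ _ m, orbitPoint, baseChange_affinePoint]
  exact hasValueAt_basisFun _ ((map_ne_zero _).2 (mul_ne_zero hω hu)) m s

theorem functionalCode_chordDivisor [IsAlgClosed k] (hL : Fintype.card L = q ^ 2) (hmq : m ≤ q)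
    (huv : v ^ q + v = u ^ (q + 1)) (hu : u ≠ 0) :
    functionalCode (orbitPoint hL ω u v huv) (chordDivisor q L k m) =
      (orbitPolynomials q m u v).map (evalPowers (ω : L) (q ^ 2 - 1)) := by
  rw [functionalCode_eq_span (riemannRoch_chordDivisor hL hmq)
    fun s hs => hasEvaluation_basisFun hL hmq huv hu hs, orbitPolynomials, Submodule.map_span,
    Set.image_image]

end Evaluation

section OrbitCode

variable {q m : ℕ} {L : Type*} [Field L] {ω u v : L}

theorem mul_sub_one_lt_sq_sub_one (hq : 1 < q) (hmq : m ≤ q) : q * (m - 1) - 1 < q ^ 2 - 1 := by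
  have : q * (m - 1) < q ^ 2 := by
    rw [sq]
    exact Nat.mul_lt_mul_of_pos_left (by lia) (by lia)
  have : 1 < q ^ 2 := Nat.one_lt_pow two_ne_zero hq
  lia

theorem linearIndepOn_evalPowers_orbitMonomial (hq : 1 < q) (hmq : m ≤ q) (hu : u ≠ 0) (hv : v ≠ 0)
    (hω : Function.Injective fun i : Fin (q ^ 2 - 1) => ω ^ (i.1 + 1)) :
    LinearIndepOn L (evalPowers ω (q ^ 2 - 1) ∘ orbitMonomial q m u v)
      (exponents m : Set (ℕ × ℕ)) := by
  refine (linearIndepOn_orbitMonomial hmq hu hv).map_injOn _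
    ((injOn_evalPowers_degreeLT hω).mono fun p hp => ?_)
  exact Polynomial.mem_degreeLT.2 (Polynomial.degree_le_natDegree.trans_lt (Nat.cast_lt.2
    ((natDegree_le_of_mem_orbitPolynomials hp).trans_lt (mul_sub_one_lt_sq_sub_one hq hmq))))

theorem finrank_map_orbitPolynomials (hq : 1 < q) (hmq : m ≤ q) (hu : u ≠ 0) (hv : v ≠ 0)
    (hω : Function.Injective fun i : Fin (q ^ 2 - 1) => ω ^ (i.1 + 1)) :
    Module.finrank L ((orbitPolynomials q m u v).map (evalPowers ω (q ^ 2 - 1))) =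
      m * (m - 1) / 2 + 1 := by
  have hspan := finrank_span_eq_card
    (linearIndepOn_evalPowers_orbitMonomial hq hmq hu hv hω).linearIndependent
  rw [← Set.image_eq_range, Set.image_comp, ← Submodule.map_span] at hspan
  rw [orbitPolynomials, hspan, ← card_exponents, ← Fintype.card_coe]
  rfl

theorem exists_mem_map_orbitPolynomials_hammingNorm_add_le [DecidableEq L] (hm : 2 ≤ m)
    (hmq : m ≤ q) (hu : u ≠ 0) (hv : v ≠ 0) (hω : ω ^ (q ^ 2 - 1) = 1) :
    ∃ p ∈ orbitPolynomials q m u v, p ≠ 0 ∧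
      hammingNorm (evalPowers ω (q ^ 2 - 1) p) + (m - 2) * (q + 1) ≤ q ^ 2 - 1 := by
  have hn : q ^ 2 - 1 = (q + 1) * (q - 1) := by simpa using Nat.sq_sub_sq q 1
  refine ⟨_, X_pow_mul_expand_mem_orbitPolynomials hm hmq hu hv (natDegree_powRootsPoly _ _).le, ?_,
    hammingNorm_evalPowers_add_le hn (by lia) hω (dvd_mul_left _ _)⟩
  exact mul_ne_zero (pow_ne_zero _ Polynomial.X_ne_zero)
    ((Polynomial.expand_ne_zero q.succ_pos).2 (monic_powRootsPoly _ _).ne_zero)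

theorem exists_isMinDistance_map_orbitPolynomials (hm : 2 ≤ m) (hmq : m ≤ q) (hu : u ≠ 0)
    (hv : v ≠ 0) (hωn : ω ^ (q ^ 2 - 1) = 1)
    (hω : Function.Injective fun i : Fin (q ^ 2 - 1) => ω ^ (i.1 + 1)) :
    ∃ d, IsMinDistance ((orbitPolynomials q m u v).map (evalPowers ω (q ^ 2 - 1))) d ∧
      (q : ℤ) ^ 2 - 1 - (q * (m - 1) - 1) ≤ d ∧ (d : ℤ) ≤ (q : ℤ) ^ 2 - 1 - (m - 2) * (q + 1) := by
  classical
  have hlt := mul_sub_one_lt_sq_sub_one (show 1 < q by lia) hmq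
  have hle {p : Polynomial L} (hp : p ∈ orbitPolynomials q m u v) (hp0 : p ≠ 0) :
      q ^ 2 - 1 ≤ hammingNorm (evalPowers ω (q ^ 2 - 1) p) + (q * (m - 1) - 1) :=
    (le_hammingNorm_evalPowers_add hω hp0).trans
      (Nat.add_le_add_left (natDegree_le_of_mem_orbitPolynomials hp) _)
  obtain ⟨w, hw, hw0, hwd⟩ :=
    exists_mem_map_orbitPolynomials_hammingNorm_add_le hm hmq hu hv hωn
  have hw_mem := Submodule.mem_map_of_mem (f := evalPowers ω (q ^ 2 - 1)) hw
  have hw_ne : evalPowers ω (q ^ 2 - 1) w ≠ 0 := fun h => by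
    have := hle hw hw0
    rw [h, hammingNorm_zero, zero_add] at this
    exact this.not_gt hlt
  obtain ⟨_, ⟨p, hp, rfl⟩, hp0, hd⟩ :=
    exists_isMinDistance_hammingNorm (Submodule.ne_bot_iff _ |>.2 ⟨_, hw_mem, hw_ne⟩)
  have hlower := hle hp fun h => hp0 (h ▸ map_zero _)
  have hupper := (Nat.add_le_add_right (hd.le_hammingNorm hw_mem hw_ne) _).trans hwd
  have hq1 : 1 ≤ q ^ 2 := by lia
  have hqm1 : 1 ≤ q * (m - 1) := Nat.mul_pos (by lia) (by lia)
  have hm1 : 1 ≤ m := by lia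
  zify [hq1, hqm1, hm1, hm] at hlower hupper
  exact ⟨_, hd, by linarith, by linarith⟩

theorem designedDistance_chordDivisor {k : Type*} [Field k] [Algebra L k] [Fintype L]
    [Fact (1 < q)] (hL : Fintype.card L = q ^ 2) (m : ℕ) :
    designedDistance (q ^ 2 - 1) (chordDivisor q L k m) = (q : ℤ) ^ 2 - 1 - m * (q - 1) := by
  have hq1 : 1 ≤ q ^ 2 := hL ▸ Fintype.card_pos
  rw [designedDistance, deg_chordDivisor hL, Nat.cast_sub hq1, Nat.cast_pow, Nat.cast_one]

end OrbitCode

end HermitianCode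

end

open HermitianCode in
theorem theorem1_general (q : ℕ) [Fact (1 < q)] (L : Type*) [Field L] [Fintype L]
    (hL : Fintype.card L = q ^ 2) (m : ℕ) (hm : 2 ≤ m) (hmq : m ≤ q)
    (ω : Lˣ) (hω : ∀ a : Lˣ, a ∈ Subgroup.zpowers ω)
    (u v : L) (huv : v ^ q + v = u ^ (q + 1)) (hu : u ≠ 0)
    (k : Type*) [Field k] [Algebra L k] [IsAlgClosed k]
    (Γ : Subgroup PGL(3, L)) (hΓ : Γ = twoPointStabilizer q L)
    (Q : Fin (q ^ 2 - 1) → curve q L) (hQ : Q = orbitPoint hL ω u v huv)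
    (G : Divisor q k) (hG : G = chordDivisor q L k m)
    (C : Submodule L (Fin (q ^ 2 - 1) → L)) (hC : C = functionalCode Q G) :
    (IsCyclic Γ ∧ Nat.card Γ = q ^ 2 - 1 ∧
      (∀ γ ∈ Γ, γ • Set.range (fun b => (chordPoint (q := q) (L := L) b).1) =
        Set.range (fun b => (chordPoint (q := q) (L := L) b).1)) ∧
      Function.Injective Q ∧
      Set.range (fun i => (Q i).1) = MulAction.orbit Γ (affinePoint u v huv).1) ∧
    (∀ f ∈ riemannRoch L G, ∃! c : Fin (q ^ 2 - 1) → L, HasEvaluation Q f c) ∧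
    (∀ f ∈ riemannRoch L G, HasEvaluation Q f 0 → f = 0) ∧
    IsCyclicCode C ∧
    Module.finrank L C = m * (m - 1) / 2 + 1 ∧
    ∃ d : ℕ, IsMinDistance C d ∧
      (q : ℤ) ^ 2 - 1 - (q * (m - 1) - 1) ≤ d ∧
      (d : ℤ) ≤ (q : ℤ) ^ 2 - 1 - (m - 2) * (q + 1) ∧
      designedDistance (q ^ 2 - 1) G + ((q : ℤ) + 1 - m) ≤ d := by
  subst hΓ hQ hG hC
  have hq : 1 < q := Fact.out
  have hv : v ≠ 0 := by
    rintro rfl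
    rw [zero_pow (by lia), add_zero] at huv
    exact pow_ne_zero _ hu huv.symm
  have hord := orderOf_eq_of_forall_mem_zpowers hL hω
  have hωn : (ω : L) ^ (q ^ 2 - 1) = 1 := by
    rw [← hord, ← Units.val_pow_eq_pow_val, pow_orderOf_eq_one, Units.val_one]
  have hinj : Function.Injective fun i : Fin (q ^ 2 - 1) => (ω : L) ^ (i.1 + 1) :=
    Units.val_injective.comp (pow_succ_injective_of_orderOf hord)
  have hRR := riemannRoch_chordDivisor (k := k) hL hmq
  have hev (s) (hs : s ∈ exponents m) := hasEvaluation_basisFun (k := k) (ω := ω) hL hmq huv hu hs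
  have hli := linearIndepOn_evalPowers_orbitMonomial hq hmq hu hv hinj
  obtain ⟨d, hd, hd_lower, hd_upper⟩ :=
    exists_isMinDistance_map_orbitPolynomials hm hmq hu hv hωn hinj
  rw [functionalCode_chordDivisor hL hmq huv hu, designedDistance_chordDivisor hL]
  exact ⟨⟨isCyclic_twoPointStabilizer hL hq, card_twoPointStabilizer hL hq,
    fun γ hγ => smul_range_chordPoint hL hq hγ, orbitPoint_injective hL hω huv hu,
    range_orbitPoint hL hq hω huv⟩, fun f hf => existsUnique_hasEvaluation hRR hev hf,
    fun f hf => eq_zero_of_hasEvaluation_zero hRR hev hli hf,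
    isCyclicCode_map_evalPowers hωn fun p => comp_mem_orbitPolynomials _,
    finrank_map_orbitPolynomials hq hmq hu hv hinj, d, hd, hd_lower, hd_upper, by linarith⟩

open HermitianCode in
theorem theorem1 (q : ℕ) [Fact (1 < q)] (L : Type*) [Field L] [Fintype L]
    (hL : Fintype.card L = q ^ 2) (m : ℕ) (hm : 2 ≤ m) (hmq : m ≤ q - 1)
    (ω : Lˣ) (hω : ∀ a : Lˣ, a ∈ Subgroup.zpowers ω)
    (u v : L) (huv : v ^ q + v = u ^ (q + 1)) (hu : u ≠ 0)
    (k : Type*) [Field k] [Algebra L k] [IsAlgClosure L k]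
    (Γ : Subgroup PGL(3, L)) (hΓ : Γ = twoPointStabilizer q L)
    (Q : Fin (q ^ 2 - 1) → curve q L) (hQ : Q = orbitPoint hL ω u v huv)
    (G : Divisor q k) (hG : G = chordDivisor q L k m)
    (C : Submodule L (Fin (q ^ 2 - 1) → L)) (hC : C = functionalCode Q G) :
    -- `Γ` is cyclic of order `q ^ 2 - 1`, leaves the support of `G` invariant, and the points `Q i`
    -- are pairwise distinct and form one orbit of `Γ`
    (IsCyclic Γ ∧ Nat.card Γ = q ^ 2 - 1 ∧
      (∀ γ ∈ Γ, γ • Set.range (fun b => (chordPoint (q := q) (L := L) b).1) =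
        Set.range (fun b => (chordPoint (q := q) (L := L) b).1)) ∧
      Function.Injective Q ∧
      Set.range (fun i => (Q i).1) = MulAction.orbit Γ (affinePoint u v huv).1) ∧
    -- the evaluation map on the Riemann-Roch space is well defined and injective
    (∀ f ∈ riemannRoch L G, ∃! c : Fin (q ^ 2 - 1) → L, HasEvaluation Q f c) ∧
    (∀ f ∈ riemannRoch L G, HasEvaluation Q f 0 → f = 0) ∧
    -- the code is cyclic, with the stated dimension and minimum distance
    IsCyclicCode C ∧
    Module.finrank L C = m * (m - 1) / 2 + 1 ∧
    ∃ d : ℕ, IsMinDistance C d ∧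
      (q : ℤ) ^ 2 - 1 - (q * (m - 1) - 1) ≤ d ∧
      (d : ℤ) ≤ (q : ℤ) ^ 2 - 1 - (m - 2) * (q + 1) ∧
      designedDistance (q ^ 2 - 1) G + ((q : ℤ) + 1 - m) ≤ d := by
  have : IsAlgClosed k := IsAlgClosure.isAlgClosed L
  exact theorem1_general q L hL m hm (hmq.trans (Nat.sub_le q 1)) ω hω u v huv hu k Γ hΓ Q hQ G hG
    C hC
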